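/- **Setting.** Let $d\ge 1$, let $|\cdot|$ be an arbitrary norm on $\mathbb{R}^d$ and $|\cdot|_2$ the Euclidean norm, let $\beta>0$, $s\in(d,2d)$ and $\gamma:=s/(2d)$. Let $\mathcal S$ be a sample of the Poisson process on $\mathbb{R}^d\times\mathbb{R}^d$ with intensity measure $1_{\{|x|_2<|y|_2\}}\,\beta|x-y|^{-s}\,dx\,dy$, and let $\mathrm{Sym}(\mathcal S):=\mathcal S\cup\{(y,x):(x,y)\in\mathcal S\}$. With $B(x,r):=\{y:|x-y|<r\}$, the restricted distance is $$\tilde D(x,y):=\inf\Big\{n+\sum_{i=0}^n|x_{i+1}-y_i| \;:\; n\ge 0,\ (x_i,y_i)\in \mathrm{Sym}(\mathcal S),\ x_i,y_i\in B(x,2|x-y|)\ \text{for } i=1,\dots,n\Big\},$$ where $y_0:=x$ and $x_{n+1}:=y$. **Proposition 2.7.** Fix $\eta\in(0,1)$ and put $c_0:=\int_{|z|^{2d}+|\tilde z|^{2d}\le 1}dz\,d\tilde z$. Then $\sqrt{\eta\beta}\,e^{-\eta\beta c_0|z|^{2d}}\,dz$ is a probability measure on $\mathbb{R}^d$. Let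 $Z,Z'$ be i.i.d. $\mathbb{R}^d$-valued random variables with this law, and let $\tilde D'$ be an independent copy of $\tilde D$ (the restricted distance of an independent copy $\mathcal S'$ of $\mathcal S$), with $\mathcal S,\mathcal S',Z,Z'$ independent. Let $\gamma_1,\gamma_2\in(0,\tfrac12(1+\gamma))$ with $\gamma_1+\gamma_2=2\gamma$, and let $\theta:=2d\big[\tfrac{1+\gamma}2-\max(\gamma_1,\gamma_2)\big]$. Then there are $c_1,c_2\in(0,\infty)$, depending only on $d,|\cdot|,s,\beta,\eta,\gamma_1,\gamma_2$, and for each $x\in\mathbb{R}^d$ there is an event $A(x)\in\sigma(Z,Z')$ with $$P(A(x))\le c_1e^{-c_2|x|^\theta},$$ such that for every $x\in\mathbb{R}^d$ the random variable $\tilde D(0,x)$ is stochastically dominated by $$\tilde D(0,|x|^{\gamma_1}Z)+\tilde D'(0,|x|^{\gamma_2}Z')+1+|x|\,1_{A(x)},$$ that is, for every $t\in\mathbb{R}$ the probability that the former exceeds $t$ is at most the probability that the latter exceeds $t$. -/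

import Mathlib

open MeasureTheory ProbabilityTheory
open scoped ENNReal

noncomputable section

namespace LongRange

/-- The space `ℝ^d`; its built-in norm `‖·‖` is the Euclidean norm `|·|₂` and its `volume` is
Lebesgue measure. The arbitrary norm `|·|` of the model is a separate argument `p` below. -/
abbrev Space (d : ℕ) : Type := EuclideanSpace ℝ (Fin d)

section PoissonProcess

variable {Ω X : Type*} [MeasurableSpace X]

/-- The sigma-algebra on `Ω` generated by a random set of points `S`, that is, by its counting
variables `ω ↦ #(S ω ∩ B)`, `B` measurable. -/
abbrev pointSigma (S : Ω → Set X) : MeasurableSpace Ω :=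
  ⨆ (B : Set X) (_ : MeasurableSet B),
    MeasurableSpace.comap (fun ω => (S ω ∩ B).encard) inferInstance

/-- The random set of points `S` is (a sample of) a Poisson process with intensity measure `μ`:
the number of points in a measurable set `B` is a Poisson variable with parameter `μ B` (almost
surely infinite if `μ B = ∞`), and the numbers of points in disjoint sets are independent.
(Realizing the process as a set, without multiplicities, is appropriate for σ-finite `μ` without
atoms.) -/
structure IsPoissonProcess [MeasurableSpace Ω] (S : Ω → Set X) (μ : Measure X)
    (P : Measure Ω) : Prop where
  measurable_count : ∀ B : Set X, MeasurableSet B → Measurable fun ω => (S ω ∩ B).encard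
  law_count : ∀ B : Set X, MeasurableSet B → μ B ≠ ∞ → ∀ k : ℕ,
    P {ω | (S ω ∩ B).encard = k} = poissonMeasure (μ B).toNNReal {k}
  count_eq_top : ∀ B : Set X, MeasurableSet B → μ B = ∞ → ∀ᵐ ω ∂P, (S ω ∩ B).encard = ⊤
  indep_count : ∀ (n : ℕ) (B : Fin n → Set X), (∀ i, MeasurableSet (B i)) →
    Pairwise (fun i j => Disjoint (B i) (B j)) →
    iIndepFun (fun i ω => (S ω ∩ B i).encard) P

end PoissonProcess

section Percolation

variable {d : ℕ}

/-- The measure `1_{|x|₂ < |y|₂} β |x - y|^{-s} dx dy` on `ℝ^d × ℝ^d`. -/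
def intensity (p : Seminorm ℝ (Space d)) (s β : ℝ) : Measure (Space d × Space d) :=
  volume.withDensity fun z =>
    if ‖z.1‖ < ‖z.2‖ then ENNReal.ofReal (β / p (z.1 - z.2) ^ s) else 0

/-- The symmetrized set of edges `S ∪ {(y, x) : (x, y) ∈ S}`. -/
def sym (S : Set (Space d × Space d)) : Set (Space d × Space d) :=
  S ∪ {e | (e.2, e.1) ∈ S}

/-- The length `n + ∑_{i=0}^n |x_{i+1} - y_i|` of the path from `x` to `y` using the edges
`(x_1, y_1), …, (x_n, y_n)` in this order, where `y_0 = x` and `x_{n+1} = y`. -/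
def pathLength (p : Seminorm ℝ (Space d)) :
    Space d → List (Space d × Space d) → Space d → ℝ
  | x, [], y => p (y - x)
  | x, e :: l, y => p (e.1 - x) + 1 + pathLength p e.2 l y

/-- The restricted distance from `x` to `y`: the infimum of the lengths of the paths using edges
of the symmetrized set `sym S` with both endpoints in the open ball of radius `2|x - y|` around
`x`. -/
def restrictedDist (p : Seminorm ℝ (Space d)) (S : Set (Space d × Space d))
    (x y : Space d) : ℝ :=
  sInf {r : ℝ | ∃ l : List (Space d × Space d),
    (∀ e ∈ l, e ∈ sym S ∧ p (e.1 - x) < 2 * p (x - y) ∧ p (e.2 - x) < 2 * p (x - y)) ∧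
    r = pathLength p x l y}

/-- `c₀`, the Lebesgue measure of `{(z, z') : |z|^{2d} + |z'|^{2d} ≤ 1}` in `ℝ^d × ℝ^d`. -/
def cZero (p : Seminorm ℝ (Space d)) : ℝ :=
  (volume : Measure (Space d × Space d)).real
    {z | p z.1 ^ (2 * d) + p z.2 ^ (2 * d) ≤ 1}

/-- The measure with Lebesgue density `√(ηβ) exp(-ηβ c₀ |z|^{2d})` on `ℝ^d`. -/
def zLaw (p : Seminorm ℝ (Space d)) (η β : ℝ) : Measure (Space d) :=
  volume.withDensity fun z =>
    ENNReal.ofReal (√(η * β) * Real.exp (-(η * β * cZero p * p z ^ (2 * d))))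

end Percolation

/-- Stochastic domination of real random variables: `P(X > t) ≤ P(Y > t)` for all `t`. -/
def StochLE {Ω : Type*} [MeasurableSpace Ω] (P : Measure Ω) (X Y : Ω → ℝ) : Prop :=
  AEMeasurable X P ∧ AEMeasurable Y P ∧ ∀ t : ℝ, P {ω | t < X ω} ≤ P {ω | t < Y ω}

end LongRange

end

open scoped Pointwise

noncomputable section

namespace LongRange

/-! Write `|x|` for `p x`, `a = |x|^γ₁`, `b = |x|^γ₂` and `r = |x|^((1+γ)/2)`, with `|x|` so large
that `4r ≤ |x|`. A path from `0` to `x` is built from a path from `0` to `u = a z`, a direct edge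
from `u` to `x + w` with `w = b z'`, and a path from `x + w` to `x`. If `|u|, |w| ≤ r`, the first
path uses only edges with both ends within `2r` of `0`, and the last only edges with both ends
within `2r` of `x`. These two families and the edges that join the ball of radius `r` around `0` to
that around `x` are independent. By translation invariance, the first two behave like independent
samples around the origin (`measure_shortPairs_le`).

In the coordinates `(z, z')`, the joining edges have intensity at least `ηβ dz dz'`: the Jacobian is
`(ab)^d = |x|^(2γd) = |x|^s`, and `η(|x| + 2r)^s ≤ |x|^s` for large `|x|` because `η < 1` and `r =
o(|x|)`. In a Poisson process of intensity exactly `ηβ dz dz'`, the point minimizing `|z|^(2d) +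
|z'|^(2d)` has the law of `(Z, Z')`. Hence, for every set `W` of pairs, `P((Z, Z') ∈ W)` is at most
the probability that some joining edge has its rescaled ends in `W` (`prod_zLaw_le_measure_hit`). No
minimal point is constructed: `setLIntegral_exp_neg_le` gives the bound analytically. With the local
edges fixed, it is applied to the set `W` of pairs whose two local paths have total length less than
`t - 1`, and then integrated over the local edges.

The event `A(x)` collects the failures: `|x|` below a threshold, or `|Z|` or `|Z'|` at least
`|x|^(θ/(2d))`. On it the right-hand side is at least `|x| + 1`, whereas the restricted distance
never exceeds `|x|`. Its probability is controlled by `zLaw_tail`. -/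

/-! ### Exponential of an extended nonnegative number -/

/-- `exp (-m)` for `m ∈ [0, ∞]`. -/
def expNeg (m : ℝ≥0∞) : ℝ≥0∞ := EReal.exp (-(m : EReal))

lemma expNeg_add (a b : ℝ≥0∞) : expNeg (a + b) = expNeg a * expNeg b := by
  rw [expNeg, expNeg, expNeg, ← EReal.exp_add, EReal.coe_ennreal_add,
    EReal.neg_add (by simp) (by simp), sub_eq_add_neg]

/-- Infinite intensities do occur: for `s > d` the density `|x - y|^(-s)` is not integrable near the
diagonal. -/
lemma expNeg_top : expNeg ∞ = 0 := by simp [expNeg]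

lemma expNeg_of_ne_top {a : ℝ≥0∞} (h : a ≠ ∞) :
    expNeg a = ENNReal.ofReal (Real.exp (-a.toReal)) := by
  lift a to NNReal using h
  rw [expNeg]
  simp only [ENNReal.coe_toReal]
  rw [← EReal.exp_coe]
  rfl

lemma expNeg_anti {a b : ℝ≥0∞} (h : a ≤ b) : expNeg b ≤ expNeg a := by
  rw [expNeg, expNeg]
  exact EReal.exp_monotone (EReal.neg_le_neg_iff.2 (EReal.coe_ennreal_le_coe_ennreal_iff.2 h))

/-! ### Configurations of points and their void events -/

/-- A configuration of points, to be equipped with the sigma-algebra of the void events. -/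
@[ext]
structure Config (X : Type*) where
  /-- The set of points of the configuration. -/
  points : Set X

section Config

variable {Ω X Y : Type*} [MeasurableSpace X] [MeasurableSpace Y]

/-- The events that there is no point in a given measurable set. -/
def voidEvents (X : Type*) [MeasurableSpace X] : Set (Set (Config X)) :=
  {V | ∃ U : Set X, MeasurableSet U ∧ V = {A | Disjoint A.points U}}

instance : MeasurableSpace (Config X) := MeasurableSpace.generateFrom (voidEvents X)

lemma isPiSystem_voidEvents : IsPiSystem (voidEvents X) := by
  rintro _ ⟨U, hU, rfl⟩ _ ⟨V, hV, rfl⟩ -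
  refine ⟨U ∪ V, hU.union hV, ?_⟩
  ext A
  simp [Set.disjoint_union_right]

lemma measurableSet_void {U : Set X} (hU : MeasurableSet U) :
    MeasurableSet {A : Config X | Disjoint A.points U} :=
  MeasurableSpace.measurableSet_generateFrom ⟨U, hU, rfl⟩

lemma measurable_config [MeasurableSpace Ω] {T : Ω → Config X}
    (h : ∀ U, MeasurableSet U → MeasurableSet {ω | Disjoint (T ω).points U}) :
    Measurable T := by
  refine measurable_generateFrom ?_
  rintro _ ⟨U, hU, rfl⟩
  exact h U hU

/-- The law of a random configuration is determined by the void probabilities. -/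
lemma map_config_eq {Ω' : Type*} [MeasurableSpace Ω] [MeasurableSpace Ω'] {P : Measure Ω}
    {P' : Measure Ω'} [IsProbabilityMeasure P] [IsProbabilityMeasure P']
    {T : Ω → Config X} {T' : Ω' → Config X} (hT : Measurable T) (hT' : Measurable T')
    (h : ∀ U, MeasurableSet U →
      P {ω | Disjoint (T ω).points U} = P' {ω | Disjoint (T' ω).points U}) :
    P.map T = P'.map T' := by
  have := Measure.isProbabilityMeasure_map (μ := P) hT.aemeasurable
  have := Measure.isProbabilityMeasure_map (μ := P') hT'.aemeasurable
  refine ext_of_generate_finite (voidEvents X) rfl isPiSystem_voidEvents ?_ (by simp)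
  rintro _ ⟨U, hU, rfl⟩
  rw [Measure.map_apply hT (measurableSet_void hU), Measure.map_apply hT' (measurableSet_void hU)]
  exact h U hU

/-- Two random configurations are independent if their void events are. -/
lemma indepFun_config [MeasurableSpace Ω] {P : Measure Ω} [IsProbabilityMeasure P]
    {T : Ω → Config X} {T' : Ω → Config Y} (hT : Measurable T) (hT' : Measurable T')
    (h : ∀ U V, MeasurableSet U → MeasurableSet V →
      P {ω | Disjoint (T ω).points U ∧ Disjoint (T' ω).points V} =
        P {ω | Disjoint (T ω).points U} * P {ω | Disjoint (T' ω).points V}) :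
    IndepFun T T' P := by
  refine IndepSets.indep hT.comap_le hT'.comap_le (isPiSystem_voidEvents.comap T)
    (isPiSystem_voidEvents.comap T') ?_ ?_ ?_
  · exact MeasurableSpace.comap_generateFrom
  · exact MeasurableSpace.comap_generateFrom
  · rw [IndepSets_iff]
    rintro _ _ ⟨_, ⟨U, hU, rfl⟩, rfl⟩ ⟨_, ⟨V, hV, rfl⟩, rfl⟩
    exact h U V hU hV

/-- The restriction of a configuration to a set. -/
def Config.restrict (K : Set X) (A : Config X) : Config X := ⟨A.points ∩ K⟩

lemma measurable_restrict {K : Set X} (hK : MeasurableSet K) :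
    Measurable (Config.restrict K) := by
  refine measurable_config fun U hU => ?_
  convert measurableSet_void (hK.inter hU) using 3
  simp only [Config.restrict, Set.disjoint_iff_inter_eq_empty, Set.inter_assoc]

/-- The preimage of a configuration under an invertible map. -/
def Config.preimage (g : X ≃ᵐ Y) (A : Config Y) : Config X := ⟨g ⁻¹' A.points⟩

lemma disjoint_preimage_iff (g : X ≃ᵐ Y) (A : Set Y) (U : Set X) :
    Disjoint (g ⁻¹' A) U ↔ Disjoint A (g.symm ⁻¹' U) := by
  simp only [Set.disjoint_left, Set.mem_preimage]
  constructor
  · intro h y hy hU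
    exact h (a := g.symm y) (by simpa using hy) hU
  · intro h x hx hU
    exact h hx (by simpa using hU)

lemma measurable_preimage (g : X ≃ᵐ Y) : Measurable (Config.preimage g) := by
  refine measurable_config fun U hU => ?_
  convert measurableSet_void (g.symm.measurable hU) using 3
  exact disjoint_preimage_iff g _ U

/-- The union of two configurations. -/
def Config.union (A B : Config X) : Config X := ⟨A.points ∪ B.points⟩

lemma measurable_union {Ω : Type*} [MeasurableSpace Ω] {T T' : Ω → Config X} (hT : Measurable T)
    (hT' : Measurable T') : Measurable fun ω => (T ω).union (T' ω) := by
  refine measurable_config fun U hU => ?_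
  convert (hT (measurableSet_void hU)).inter (hT' (measurableSet_void hU)) using 1
  ext ω
  simp [Config.union, Set.disjoint_union_left]

end Config

lemma encard_eq_zero_iff_disjoint {X : Type*} (A B : Set X) :
    (A ∩ B).encard = 0 ↔ Disjoint A B := by
  rw [Set.encard_eq_zero, Set.disjoint_iff_inter_eq_empty]

section Poisson

variable {Ω X : Type*} [MeasurableSpace X]

lemma measurable_config_pointSigma (S : Ω → Set X) :
    Measurable[pointSigma S] fun ω => (⟨S ω⟩ : Config X) := by
  let := pointSigma S
  refine measurable_config fun U hU => ?_
  have : Measurable fun ω => (S ω ∩ U).encard := by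
    rw [measurable_iff_comap_le]
    exact le_iSup₂_of_le U hU le_rfl
  convert this (measurableSet_singleton 0) using 1
  ext ω
  exact (encard_eq_zero_iff_disjoint _ _).symm

lemma IsPoissonProcess.pointSigma_le [MeasurableSpace Ω] {S : Ω → Set X} {μ : Measure X}
    {P : Measure Ω} (h : IsPoissonProcess S μ P) : pointSigma S ≤ ‹MeasurableSpace Ω› :=
  iSup₂_le fun B hB => (h.measurable_count B hB).comap_le

lemma IsPoissonProcess.measurable [MeasurableSpace Ω] {S : Ω → Set X} {μ : Measure X}
    {P : Measure Ω} (h : IsPoissonProcess S μ P) : Measurable fun ω => (⟨S ω⟩ : Config X) :=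
  (measurable_config_pointSigma S).mono h.pointSigma_le le_rfl

lemma IsPoissonProcess.measure_disjoint [MeasurableSpace Ω] {S : Ω → Set X} {μ : Measure X}
    {P : Measure Ω} (h : IsPoissonProcess S μ P) {U : Set X} (hU : MeasurableSet U) :
    P {ω | Disjoint (S ω) U} = expNeg (μ U) := by
  simp_rw [← encard_eq_zero_iff_disjoint]
  by_cases hm : μ U = ∞
  · rw [hm, expNeg_top]
    have := h.count_eq_top U hU hm
    refine measure_mono_null (fun ω (hω : _ = _) => ?_) (ae_iff.1 this)
    rw [Set.mem_ofPred_eq, hω]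
    exact ENat.zero_ne_top
  · rw [expNeg_of_ne_top hm]
    have := h.law_count U hU hm 0
    simp only [Nat.cast_zero] at this
    rw [this, poissonMeasure_singleton]
    simp [ENNReal.coe_toNNReal_eq_toReal]

end Poisson

/-! ### Measurability of the restricted distance -/

/-- The existence of finitely many points of a configuration in an open position is a measurable
event. -/
lemma measurableSet_exists_tuple {E Y : Type*} [TopologicalSpace E] [SecondCountableTopology E]
    [MeasurableSpace E] [BorelSpace E] [TopologicalSpace Y] [SecondCountableTopology Y]
    [MeasurableSpace Y] [BorelSpace Y] (n : ℕ) {G : Set (Y × (Fin n → E))} (hG : IsOpen G) :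
    MeasurableSet {q : Config E × Y | ∃ e : Fin n → E, (∀ i, e i ∈ q.1.points) ∧ (q.2, e) ∈ G} := by
  let I := {b : TopologicalSpace.countableBasis Y × (Fin n → TopologicalSpace.countableBasis E) //
    (b.1 : Set Y) ×ˢ Set.univ.pi (fun i => (b.2 i : Set E)) ⊆ G}
  -- Cover `G` by countably many basic boxes. A tuple in a box exists iff the configuration meets
  -- each factor; the entries may coincide, so void events suffice.
  have key : {q : Config E × Y | ∃ e : Fin n → E, (∀ i, e i ∈ q.1.points) ∧ (q.2, e) ∈ G} =
      ⋃ b : I, (⋂ i, {A : Config E | Disjoint A.points (b.1.2 i : Set E)}ᶜ) ×ˢ (b.1.1 : Set Y) := by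
    ext ⟨A, y⟩
    simp only [Set.mem_ofPred_eq, Set.mem_iUnion, Set.mem_prod, Set.mem_iInter, Set.mem_compl_iff,
      Set.not_disjoint_iff]
    constructor
    · rintro ⟨e, heA, heG⟩
      obtain ⟨V, W, hV, hW, hyV, heW, hVW⟩ := isOpen_prod_iff.1 hG y e heG
      obtain ⟨V', hV', hyV', hVV'⟩ :=
        (TopologicalSpace.isBasis_countableBasis Y).exists_subset_of_mem_open hyV hV
      obtain ⟨u, hu, huW⟩ := isOpen_pi_iff'.1 hW e heW
      have hb : ∀ i, ∃ U' ∈ TopologicalSpace.countableBasis E, e i ∈ U' ∧ U' ⊆ u i := fun i =>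
        (TopologicalSpace.isBasis_countableBasis E).exists_subset_of_mem_open (hu i).2 (hu i).1
      choose U' hU' heU' hUu using hb
      refine ⟨⟨⟨⟨V', hV'⟩, fun i => ⟨U' i, hU' i⟩⟩, ?_⟩, fun i => ⟨e i, heA i, heU' i⟩, hyV'⟩
      refine (Set.prod_mono hVV' ?_).trans hVW
      exact (Set.pi_mono fun i _ => hUu i).trans huW
    · rintro ⟨b, hb, hy⟩
      choose e heA heU using hb
      exact ⟨e, heA, b.2 ⟨hy, fun i _ => heU i⟩⟩
  have hbY : ∀ U : TopologicalSpace.countableBasis Y, MeasurableSet (U : Set Y) := fun U =>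
    (TopologicalSpace.isOpen_of_mem_countableBasis U.2).measurableSet
  have hbE : ∀ U : TopologicalSpace.countableBasis E, MeasurableSet (U : Set E) := fun U =>
    (TopologicalSpace.isOpen_of_mem_countableBasis U.2).measurableSet
  rw [key]
  have : Countable I := inferInstance
  exact MeasurableSet.iUnion fun b =>
    (MeasurableSet.iInter fun i => (measurableSet_void (hbE _)).compl).prod (hbY _)

variable {d : ℕ}

/-- A convex function on a finite-dimensional space is continuous. -/
lemma continuous_seminorm (p : Seminorm ℝ (Space d)) : Continuous p := by
  refine Seminorm.continuous_of_continuousAt_zero ?_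
  have h : ConvexOn ℝ Set.univ p := p.convexOn
  exact (h.continuousOn isOpen_univ).continuousAt Filter.univ_mem

lemma sym_sym (S : Set (Space d × Space d)) : sym (sym S) = sym S := by
  ext e
  simp only [sym, Set.mem_union, Set.mem_ofPred_eq]
  tauto

lemma sym_mono {S T : Set (Space d × Space d)} (h : S ⊆ T) : sym S ⊆ sym T :=
  Set.union_subset_union h fun _ he => h he

lemma pathLength_nonneg (p : Seminorm ℝ (Space d)) (l : List (Space d × Space d)) :
    ∀ x y, 0 ≤ pathLength p x l y := by
  induction l with
  | nil => intro x y; exact apply_nonneg p _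
  | cons e l ih =>
    intro x y
    have := ih e.2 y
    have := apply_nonneg p (e.1 - x)
    rw [pathLength]
    linarith

lemma restrictedDist_lt_iff (p : Seminorm ℝ (Space d)) (S : Set (Space d × Space d))
    (x y : Space d) (t : ℝ) : restrictedDist p S x y < t ↔
      ∃ l : List (Space d × Space d),
        (∀ e ∈ l, e ∈ sym S ∧ p (e.1 - x) < 2 * p (x - y) ∧ p (e.2 - x) < 2 * p (x - y)) ∧
        pathLength p x l y < t := by
  rw [restrictedDist, csInf_lt_iff]
  · constructor
    · rintro ⟨_, ⟨l, hl, rfl⟩, h⟩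
      exact ⟨l, hl, h⟩
    · rintro ⟨l, hl, h⟩
      exact ⟨_, ⟨l, hl, rfl⟩, h⟩
  · refine ⟨0, ?_⟩
    rintro _ ⟨l, -, rfl⟩
    exact pathLength_nonneg p l x y
  · exact ⟨_, [], by simp, rfl⟩

lemma restrictedDist_nonneg (p : Seminorm ℝ (Space d)) (S : Set (Space d × Space d))
    (x y : Space d) : 0 ≤ restrictedDist p S x y := by
  by_contra! h
  obtain ⟨l, -, hl⟩ := (restrictedDist_lt_iff p S x y 0).1 h
  exact absurd hl (not_lt.2 (pathLength_nonneg p l x y))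

lemma restrictedDist_le (p : Seminorm ℝ (Space d)) (S : Set (Space d × Space d))
    (x : Space d) : restrictedDist p S 0 x ≤ p x := by
  refine le_of_forall_gt fun t ht => ?_
  exact (restrictedDist_lt_iff p S 0 x t).2 ⟨[], by simp, by simpa [pathLength] using ht⟩

lemma restrictedDist_sym (p : Seminorm ℝ (Space d)) (S : Set (Space d × Space d))
    (x y : Space d) : restrictedDist p (sym S) x y = restrictedDist p S x y := by
  rw [restrictedDist, restrictedDist, sym_sym]

lemma continuous_pathLength (p : Seminorm ℝ (Space d)) (n : ℕ) :
    Continuous fun q : (Space d × Space d) × (Fin n → Space d × Space d) =>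
      pathLength p q.1.1 (List.ofFn q.2) q.1.2 := by
  have hp := continuous_seminorm p
  induction n with
  | zero =>
    simp only [List.ofFn_zero, pathLength]
    fun_prop
  | succ n ih =>
    simp only [List.ofFn_succ, pathLength]
    refine (by fun_prop : Continuous fun q : (Space d × Space d) ×
      (Fin (n + 1) → Space d × Space d) => p ((q.2 0).1 - q.1.1) + 1).add ?_
    exact ih.comp (by fun_prop : Continuous fun q : (Space d × Space d) ×
      (Fin (n + 1) → Space d × Space d) =>
        (((q.2 0).2, q.1.2), fun i : Fin n => q.2 i.succ))

/-- The restricted distance from the origin is a jointly measurable function of the set of edges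
and the end point. -/
lemma measurable_restrictedDist (p : Seminorm ℝ (Space d)) :
    Measurable fun q : Config (Space d × Space d) × Space d =>
      restrictedDist p q.1.points 0 q.2 := by
  have hp := continuous_seminorm p
  have hsym : Measurable fun A : Config (Space d × Space d) =>
      (⟨sym A.points⟩ : Config (Space d × Space d)) :=
    measurable_union measurable_id
      (measurable_preimage (MeasurableEquiv.prodComm (α := Space d) (β := Space d)))
  refine measurable_of_Iio fun t => ?_
  -- For each number `n` of edges, all conditions are strict inequalities between continuous
  -- functions, hence open in the end point and the edges.
  have key : (fun q : Config (Space d × Space d) × Space d =>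
      restrictedDist p q.1.points 0 q.2) ⁻¹' Set.Iio t =
      (Prod.map (fun A => (⟨sym A.points⟩ : Config (Space d × Space d))) id) ⁻¹'
      ⋃ n : ℕ, {q : Config (Space d × Space d) × Space d |
        ∃ e : Fin n → Space d × Space d, (∀ i, e i ∈ q.1.points) ∧
        (q.2, e) ∈ {r : Space d × (Fin n → Space d × Space d) |
          (∀ i, p (r.2 i).1 < 2 * p r.1 ∧ p (r.2 i).2 < 2 * p r.1) ∧
          pathLength p 0 (List.ofFn r.2) r.1 < t}} := by
    ext ⟨A, w⟩
    simp only [Set.mem_preimage, Set.mem_Iio, restrictedDist_lt_iff, List.exists_iff_exists_tuple,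
      Set.mem_iUnion, Set.mem_ofPred_eq, Prod.map, id, sub_zero, zero_sub, map_neg_eq_map,
      List.forall_mem_ofFn_iff]
    refine exists_congr fun n => exists_congr fun e => ?_
    rw [forall_and]
    tauto
  rw [key]
  refine (hsym.prodMap measurable_id) (MeasurableSet.iUnion fun n => ?_)
  refine measurableSet_exists_tuple n ?_
  have hopen : {r : Space d × (Fin n → Space d × Space d) |
      (∀ i, p (r.2 i).1 < 2 * p r.1 ∧ p (r.2 i).2 < 2 * p r.1) ∧
      pathLength p 0 (List.ofFn r.2) r.1 < t} =
      (⋂ i, {r | p (r.2 i).1 < 2 * p r.1} ∩ {r | p (r.2 i).2 < 2 * p r.1}) ∩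
        {r | pathLength p 0 (List.ofFn r.2) r.1 < t} := by
    ext r
    simp [Set.mem_iInter]
  rw [hopen]
  refine (isOpen_iInter_of_finite fun i => (isOpen_lt (by fun_prop) (by fun_prop)).inter
    (isOpen_lt (by fun_prop) (by fun_prop))).inter (isOpen_lt ?_ continuous_const)
  exact (continuous_pathLength p n).comp (by fun_prop :
    Continuous fun r : Space d × (Fin n → Space d × Space d) => (((0 : Space d), r.1), r.2))

lemma measurable_restrictedDist_comp (p : Seminorm ℝ (Space d)) {Ω : Type*} [MeasurableSpace Ω]
    {S : Ω → Set (Space d × Space d)} {w : Ω → Space d}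
    (hS : Measurable fun ω => (⟨S ω⟩ : Config (Space d × Space d))) (hw : Measurable w) :
    Measurable fun ω => restrictedDist p (S ω) 0 (w ω) :=
  (measurable_restrictedDist p).comp (hS.prodMk hw)

/-! ### Concatenation of paths -/

lemma pathLength_append (p : Seminorm ℝ (Space d)) (l l' : List (Space d × Space d))
    (e : Space d × Space d) (y : Space d) : ∀ x, pathLength p x (l ++ e :: l') y =
      pathLength p x l e.1 + 1 + pathLength p e.2 l' y := by
  induction l with
  | nil => intro x; simp [pathLength]
  | cons f l ih => intro x; simp only [List.cons_append, pathLength, ih]; ring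

lemma pathLength_reverse (p : Seminorm ℝ (Space d)) (l : List (Space d × Space d)) :
    ∀ x y, pathLength p y (l.reverse.map Prod.swap) x = pathLength p x l y := by
  induction l with
  | nil => intro x y; simp [pathLength, map_sub_rev]
  | cons e l ih =>
    intro x y
    simp only [List.reverse_cons, List.map_append, List.map_cons, List.map_nil, pathLength_append,
      pathLength, Prod.fst_swap, Prod.snd_swap, ih, map_sub_rev p x e.1]
    ring

lemma pathLength_translate (p : Seminorm ℝ (Space d)) (v : Space d)
    (l : List (Space d × Space d)) :
    ∀ x y, pathLength p (x + v) (l.map fun e => (e.1 + v, e.2 + v)) (y + v) =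
      pathLength p x l y := by
  induction l with
  | nil => intro x y; simp [pathLength]
  | cons e l ih => intro x y; simp [pathLength, ih]

/-- Two restricted paths, around `0` and around `x`, are joined by an edge from `u` to `x + w`. -/
lemma restrictedDist_concat_lt (p : Seminorm ℝ (Space d)) {S S₁ S₂ : Set (Space d × Space d)}
    {u w x : Space d} {t : ℝ} (hu : 2 * p u < p x) (hw : 2 * p w < p x)
    (h₁ : S₁ ⊆ S) (h₂ : ∀ e ∈ S₂, (e.1 + x, e.2 + x) ∈ S) (he : (u, w + x) ∈ S)
    (ht : restrictedDist p S₁ 0 u + restrictedDist p S₂ 0 w + 1 < t) :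
    restrictedDist p S 0 x < t := by
  obtain ⟨a, ha, hat⟩ := exists_between
    (show restrictedDist p S₁ 0 u < t - 1 - restrictedDist p S₂ 0 w by linarith)
  obtain ⟨l₁, hl₁, hlt₁⟩ := (restrictedDist_lt_iff p S₁ 0 u a).1 ha
  obtain ⟨l₂, hl₂, hlt₂⟩ := (restrictedDist_lt_iff p S₂ 0 w (t - 1 - a)).1 (by linarith)
  simp only [sub_zero, zero_sub, map_neg_eq_map] at hl₁ hl₂
  rw [restrictedDist_lt_iff]
  -- The second path is translated by `x` and run backwards, from `w + x` to `x`. All edges stay in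
  -- the ball of radius `2|x|` around `0`, since `2|u| < |x|` and `|x| + 2|w| < 2|x|`.
  refine ⟨l₁ ++ (u, w + x) :: ((l₂.map fun e => (e.1 + x, e.2 + x)).reverse.map Prod.swap),
    ?_, ?_⟩
  · have hadd : ∀ y, p (y + x) ≤ p y + p x := fun y => map_add_le_add p y x
    have := apply_nonneg p u
    have := apply_nonneg p w
    simp only [sub_zero, zero_sub, map_neg_eq_map]
    intro e hmem
    rcases List.mem_append.1 hmem with h | h
    · obtain ⟨h1, h2, h3⟩ := hl₁ e h
      exact ⟨sym_mono h₁ h1, by linarith, by linarith⟩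
    · rcases List.mem_cons.1 h with rfl | h
      · exact ⟨Or.inl he, by dsimp only; linarith, by have := hadd w; dsimp only; linarith⟩
      · simp only [List.mem_map, List.mem_reverse] at h
        obtain ⟨_, ⟨f, hf, rfl⟩, rfl⟩ := h
        obtain ⟨h1, h2, h3⟩ := hl₂ f hf
        refine ⟨?_, ?_, ?_⟩
        · rcases h1 with h1 | h1
          · exact Or.inr (h₂ _ h1)
          · exact Or.inl (h₂ _ h1)
        · have := hadd f.2
          simp only [Prod.swap_prod_mk]
          linarith
        · have := hadd f.1
          simp only [Prod.swap_prod_mk]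
          linarith
  · rw [pathLength_append, pathLength_reverse]
    have := pathLength_translate p x l₂ 0 w
    rw [zero_add] at this
    dsimp only
    linarith

/-- The restricted distance only depends on the edges within a large enough ball. -/
lemma restrictedDist_inter (p : Seminorm ℝ (Space d)) (S : Set (Space d × Space d))
    {u : Space d} {r : ℝ} (hu : p u ≤ r) :
    restrictedDist p (S ∩ {e | p e.1 < 2 * r ∧ p e.2 < 2 * r}) 0 u = restrictedDist p S 0 u := by
  rw [restrictedDist, restrictedDist]
  congr 1
  ext c
  refine exists_congr fun l => and_congr_left fun _ => forall₂_congr fun e _ => ?_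
  simp only [sub_zero, zero_sub, map_neg_eq_map, sym, Set.mem_union, Set.mem_inter_iff,
    Set.mem_ofPred_eq]
  refine and_congr_left fun h => ?_
  have h1 : p e.1 < 2 * r := by linarith [h.1]
  have h2 : p e.2 < 2 * r := by linarith [h.2]
  tauto

/-! ### An inequality for the smallest point of a Poisson process -/

section Bathtub

variable {X : Type*} [MeasurableSpace X] {ρ : Measure X} {g : X → ℝ}

lemma lintegral_exp_neg_of_map_eq (hg : Measurable g)
    (hmap : ρ.map g = volume.restrict (Set.Ici 0)) :
    ∫⁻ z, ENNReal.ofReal (Real.exp (-g z)) ∂ρ = 1 := by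
  have h : ∫⁻ z, ENNReal.ofReal (Real.exp (-g z)) ∂ρ =
      ∫⁻ r, ENNReal.ofReal (Real.exp (-r)) ∂(ρ.map g) :=
    (lintegral_map (f := fun r => ENNReal.ofReal (Real.exp (-r))) (by fun_prop) hg).symm
  rw [h, hmap, ← restrict_Ioi_eq_restrict_Ici, ← ofReal_integral_eq_lintegral_ofReal
    (integrableOn_exp_neg_Ioi 0) (Filter.Eventually.of_forall fun r => (Real.exp_pos _).le),
    integral_exp_neg_Ioi]
  simp

lemma lintegral_exp_neg_sub (M : ℝ) (hM : 0 ≤ M) :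
    ∫⁻ r in Set.Ici 0, ENNReal.ofReal (Real.exp (-r) - Real.exp (-M)) =
      ENNReal.ofReal (1 - Real.exp (-M) - M * Real.exp (-M)) := by
  have h1 : ∫⁻ r in Set.Ici 0, ENNReal.ofReal (Real.exp (-r) - Real.exp (-M)) =
      ∫⁻ r in Set.Ioc 0 M, ENNReal.ofReal (Real.exp (-r) - Real.exp (-M)) := by
    rw [← restrict_Ioi_eq_restrict_Ici]
    rw [← lintegral_indicator measurableSet_Ioi, ← lintegral_indicator measurableSet_Ioc]
    refine lintegral_congr fun r => ?_
    by_cases h0 : 0 < r <;> by_cases hr : r ≤ M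
    · simp [h0, hr]
    · have : Real.exp (-r) - Real.exp (-M) ≤ 0 := by simpa using (not_le.1 hr).le
      simp [h0, hr, ENNReal.ofReal_of_nonpos this]
    · simp [h0]
    · simp [h0]
  have hint : IntervalIntegrable (fun r => Real.exp (-r)) volume 0 M :=
    (by fun_prop : Continuous fun r : ℝ => Real.exp (-r)).intervalIntegrable _ _
  rw [h1, ← ofReal_integral_eq_lintegral_ofReal, ← intervalIntegral.integral_of_le hM,
    intervalIntegral.integral_sub hint (by simp)]
  · simp
  · exact ((by fun_prop : Continuous fun r : ℝ => Real.exp (-r) - Real.exp (-M)).integrableOn_Icc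
      (a := 0) (b := M)).mono_set Set.Ioc_subset_Icc_self
  · refine (ae_restrict_iff' measurableSet_Ioc).2 (Filter.Eventually.of_forall fun r hr => ?_)
    simpa using hr.2

/-- If `ρ {g ≤ r} = r`, then the probability that the point of a Poisson process of intensity `ρ`
with the smallest value of `g` lies in `W` is at most the probability that there is a point
in `W`. -/
lemma setLIntegral_exp_neg_le (hg : Measurable g)
    (hmap : ρ.map g = volume.restrict (Set.Ici 0)) (W : Set X) :
    ∫⁻ z in W, ENNReal.ofReal (Real.exp (-g z)) ∂ρ ≤ 1 - expNeg (ρ W) := by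
  by_cases hW : ρ W = ∞
  · rw [hW, expNeg_top, tsub_zero, ← lintegral_exp_neg_of_map_eq hg hmap]
    exact setLIntegral_le_lintegral _ _
  set M := (ρ W).toReal with hM
  have hM0 : 0 ≤ M := ENNReal.toReal_nonneg
  have hexp : (1 : ℝ) - Real.exp (-M) - M * Real.exp (-M) ≥ 0 := by
    have := Real.add_one_le_exp M
    have h2 : Real.exp M * Real.exp (-M) = 1 := by rw [← Real.exp_add]; simp
    have := mul_le_mul_of_nonneg_right this (Real.exp_pos (-M)).le
    linarith
  calc ∫⁻ z in W, ENNReal.ofReal (Real.exp (-g z)) ∂ρ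
      -- Bathtub principle: among sets of mass `M` the integral is largest for `{g ≤ M}`. The excess
      -- of `exp (-g)` over the level `exp (-M)`, truncated at `0` by `ENNReal.ofReal`, is
      -- integrated over the whole space.
      ≤ ∫⁻ z in W, (ENNReal.ofReal (Real.exp (-M)) +
          ENNReal.ofReal (Real.exp (-g z) - Real.exp (-M))) ∂ρ := by
        refine lintegral_mono fun z => ?_
        refine le_trans (ENNReal.ofReal_le_ofReal ?_) ENNReal.ofReal_add_le
        linarith
    _ = ENNReal.ofReal (Real.exp (-M)) * ρ W +
          ∫⁻ z in W, ENNReal.ofReal (Real.exp (-g z) - Real.exp (-M)) ∂ρ := by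
        rw [lintegral_add_left measurable_const, setLIntegral_const]
    _ ≤ ENNReal.ofReal (Real.exp (-M)) * ρ W +
          ∫⁻ z, ENNReal.ofReal (Real.exp (-g z) - Real.exp (-M)) ∂ρ := by
        gcongr
        exact Measure.restrict_le_self
    _ = ENNReal.ofReal (Real.exp (-M)) * ENNReal.ofReal M +
          ENNReal.ofReal (1 - Real.exp (-M) - M * Real.exp (-M)) := by
        rw [hM, ENNReal.ofReal_toReal hW, ← hM, ← lintegral_exp_neg_sub M hM0, ← hmap,
          lintegral_map (by fun_prop) hg]
    _ = 1 - expNeg (ρ W) := by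
        rw [← ENNReal.ofReal_mul (Real.exp_pos _).le, ← ENNReal.ofReal_add (by positivity) hexp,
          expNeg_of_ne_top hW, ← ENNReal.ofReal_one, ← ENNReal.ofReal_sub _ (Real.exp_pos _).le]
        congr 1
        ring

lemma map_eq_restrict_Ici (hg : Measurable g)
    (h : ∀ r, 0 ≤ r → ρ {z | g z ≤ r} = ENNReal.ofReal r) (h0 : ∀ z, 0 ≤ g z) :
    ρ.map g = volume.restrict (Set.Ici 0) := by
  have h' : ∀ r, ρ.map g (Set.Iic r) = ENNReal.ofReal r := by
    intro r
    rw [Measure.map_apply hg measurableSet_Iic]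
    rcases le_or_gt 0 r with hr | hr
    · exact h r hr
    · rw [ENNReal.ofReal_of_nonpos hr.le]
      convert measure_empty (μ := ρ)
      ext z
      simpa using hr.trans_le (h0 z)
  have hvol : ∀ r : ℝ, volume.restrict (Set.Ici 0) (Set.Iic r) = ENNReal.ofReal r := by
    intro r
    rw [Measure.restrict_apply measurableSet_Iic, Set.inter_comm, Set.Ici_inter_Iic]
    simp
  symm
  refine Measure.ext_of_Ioc _ _ fun a b hab => ?_
  rw [← Set.Iic_sdiff_Iic, measure_sdiff (Set.Iic_subset_Iic.2 hab.le)
    measurableSet_Iic.nullMeasurableSet (by rw [hvol]; simp),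
    measure_sdiff (Set.Iic_subset_Iic.2 hab.le)
    measurableSet_Iic.nullMeasurableSet (by rw [h']; simp), h', h', hvol, hvol]

end Bathtub

/-! ### The law of the rescaled end points -/

section Law

/-- The function `|z|^{2d} + |z'|^{2d}`. -/
def powSum (p : Seminorm ℝ (Space d)) (z : Space d × Space d) : ℝ :=
  p z.1 ^ (2 * d) + p z.2 ^ (2 * d)

lemma continuous_powSum (p : Seminorm ℝ (Space d)) : Continuous (powSum p) := by
  have := continuous_seminorm p
  unfold powSum
  fun_prop

lemma powSum_nonneg (p : Seminorm ℝ (Space d)) (z : Space d × Space d) : 0 ≤ powSum p z :=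
  add_nonneg (pow_nonneg (apply_nonneg p _) _) (pow_nonneg (apply_nonneg p _) _)

lemma powSum_smul (p : Seminorm ℝ (Space d)) {c : ℝ} (hc : 0 ≤ c) (z : Space d × Space d) :
    powSum p (c • z) = c ^ (2 * d) * powSum p z := by
  simp only [powSum, Prod.smul_fst, Prod.smul_snd, map_smul_eq_mul, Real.norm_eq_abs,
    abs_of_nonneg hc, mul_pow]
  ring

lemma exists_mul_norm_le (p : Seminorm ℝ (Space d)) (hp : ∀ x, p x = 0 → x = 0) :
    ∃ c : ℝ, 0 < c ∧ ∀ x, c * ‖x‖ ≤ p x := by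
  rcases (Metric.sphere (0 : Space d) 1).eq_empty_or_nonempty with h | h
  · refine ⟨1, one_pos, fun x => ?_⟩
    have hx : x = 0 := by
      by_contra hx
      have : ‖x‖⁻¹ • x ∈ Metric.sphere (0 : Space d) 1 := by
        simp [norm_smul, inv_mul_cancel₀ (norm_ne_zero_iff.2 hx)]
      simp [h] at this
    simp [hx]
  · obtain ⟨y, hy, hmin⟩ := (isCompact_sphere (0 : Space d) 1).exists_isMinOn h
      (continuous_seminorm p).continuousOn
    have hy0 : y ≠ 0 := by
      rintro rfl
      simp at hy
    refine ⟨p y, (apply_nonneg p y).lt_of_ne fun h => hy0 (hp y h.symm), fun x => ?_⟩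
    rcases eq_or_ne x 0 with rfl | hx
    · simp
    have hx' : ‖x‖⁻¹ • x ∈ Metric.sphere (0 : Space d) 1 := by
      simp [norm_smul, inv_mul_cancel₀ (norm_ne_zero_iff.2 hx)]
    have := hmin hx'
    simp only [Set.mem_ofPred_eq, map_smul_eq_mul, norm_inv, norm_norm] at this
    rwa [← div_eq_inv_mul, le_div_iff₀ (norm_pos_iff.2 hx)] at this

instance : (volume : Measure (Space d × Space d)).IsAddHaarMeasure := by
  rw [Measure.volume_eq_prod]
  infer_instance

lemma volume_powSum_le_one_ne_top (p : Seminorm ℝ (Space d)) (hp : ∀ x, p x = 0 → x = 0)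
    (hd : d ≠ 0) : volume {z | powSum p z ≤ 1} ≠ ∞ := by
  obtain ⟨c, hc, h⟩ := exists_mul_norm_le p hp
  refine ((measure_mono fun z hz => ?_).trans_lt
    (isCompact_closedBall (0 : Space d × Space d) c⁻¹).measure_lt_top).ne
  have hz : powSum p z ≤ 1 := hz
  have h1 := pow_nonneg (apply_nonneg p z.1) (2 * d)
  have h2 := pow_nonneg (apply_nonneg p z.2) (2 * d)
  rw [powSum] at hz
  have h1' := (pow_le_one_iff_of_nonneg (apply_nonneg p z.1) (by positivity)).1
    (show p z.1 ^ (2 * d) ≤ 1 by linarith)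
  have h2' := (pow_le_one_iff_of_nonneg (apply_nonneg p z.2) (by positivity)).1
    (show p z.2 ^ (2 * d) ≤ 1 by linarith)
  rw [mem_closedBall_zero_iff, Prod.norm_def, max_le_iff, ← one_div, le_div_iff₀ hc,
    le_div_iff₀ hc]
  constructor
  · linarith [h z.1]
  · linarith [h z.2]

lemma cZero_pos (p : Seminorm ℝ (Space d)) (hp : ∀ x, p x = 0 → x = 0) (hd : d ≠ 0) :
    0 < cZero p := by
  refine ENNReal.toReal_pos ?_ (volume_powSum_le_one_ne_top p hp hd)
  have hopen : IsOpen {z | powSum p z < 1} := isOpen_lt (continuous_powSum p) continuous_const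
  have := hopen.measure_pos volume ⟨0, by simp [powSum, hd]⟩
  exact (this.trans_le (measure_mono fun z (hz : powSum p z < 1) =>
    show powSum p z ≤ 1 from hz.le)).ne'

/-- The function `powSum` is homogeneous of degree `2d` on a space of dimension `2d`, so the volume
of its sublevel sets is linear in the level. This is what the exponent `2d` is for. -/
lemma volume_powSum_le (p : Seminorm ℝ (Space d)) (hp : ∀ x, p x = 0 → x = 0) (hd : d ≠ 0)
    {r : ℝ} (hr : 0 ≤ r) : volume {z | powSum p z ≤ r} = ENNReal.ofReal (r * cZero p) := by
  rcases hr.eq_or_lt with rfl | hr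
  · rw [zero_mul, ENNReal.ofReal_zero]
    have : Nontrivial (Space d) := by
      have : NeZero d := ⟨hd⟩
      infer_instance
    have : NullSingletonClass (volume : Measure (Space d × Space d)) :=
      Measure.prod.instNullSingletonClass_fst
    refine measure_mono_null (t := {0}) (fun z (hz : powSum p z ≤ 0) => ?_) (measure_singleton _)
    have h1 := pow_nonneg (apply_nonneg p z.1) (2 * d)
    have h2 := pow_nonneg (apply_nonneg p z.2) (2 * d)
    rw [powSum] at hz
    have hd' : 2 * d ≠ 0 := by positivity
    exact Prod.ext (hp _ ((pow_eq_zero_iff hd').1 (le_antisymm (by linarith) h1)))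
      (hp _ ((pow_eq_zero_iff hd').1 (le_antisymm (by linarith) h2)))
  · set c := r ^ ((2 * d : ℕ) : ℝ)⁻¹ with hc
    have hc0 : 0 < c := Real.rpow_pos_of_pos hr _
    have hcr : c ^ (2 * d) = r := Real.rpow_inv_natCast_pow hr.le (by positivity)
    have hset : {z | powSum p z ≤ r} = c • {z : Space d × Space d | powSum p z ≤ 1} := by
      ext z
      rw [Set.mem_smul_set_iff_inv_smul_mem₀ hc0.ne', Set.mem_ofPred_eq, Set.mem_ofPred_eq,
        powSum_smul p (inv_nonneg.2 hc0.le), inv_pow, hcr, inv_mul_le_iff₀ hr, mul_one]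
    rw [hset, Measure.addHaar_smul, Module.finrank_prod, finrank_euclideanSpace_fin, ← two_mul,
      hcr, abs_of_pos hr, ENNReal.ofReal_mul hr.le, cZero, measureReal_def, ENNReal.ofReal_toReal]
    · rfl
    · exact volume_powSum_le_one_ne_top p hp hd

lemma map_powSum (p : Seminorm ℝ (Space d)) (hp : ∀ x, p x = 0 → x = 0) (hd : d ≠ 0)
    {κ : ℝ} (hκ : 0 < κ) :
    (ENNReal.ofReal κ • (volume : Measure (Space d × Space d))).map
      (fun z => κ * cZero p * powSum p z) = volume.restrict (Set.Ici 0) := by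
  have hc := cZero_pos p hp hd
  refine map_eq_restrict_Ici ?_ (fun r hr => ?_) fun z =>
    mul_nonneg (by positivity) (powSum_nonneg p z)
  · exact ((continuous_powSum p).const_mul _).measurable
  · have : {z | κ * cZero p * powSum p z ≤ r} = {z | powSum p z ≤ r / (κ * cZero p)} := by
      ext z
      rw [Set.mem_ofPred_eq, Set.mem_ofPred_eq, le_div_iff₀ (by positivity), mul_comm]
    rw [this, Measure.smul_apply, volume_powSum_le p hp hd (by positivity), smul_eq_mul,
      ← ENNReal.ofReal_mul hκ.le]
    congr 1
    field_simp

instance (p : Seminorm ℝ (Space d)) (η β : ℝ) : SFinite (zLaw p η β) := by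
  unfold zLaw; infer_instance

lemma measurable_zLaw_density (p : Seminorm ℝ (Space d)) (η β : ℝ) :
    Measurable fun z : Space d =>
      ENNReal.ofReal (√(η * β) * Real.exp (-(η * β * cZero p * p z ^ (2 * d)))) := by
  have := (continuous_seminorm p).measurable
  fun_prop

lemma zLaw_prod_zLaw (p : Seminorm ℝ (Space d)) {η β : ℝ} (h : 0 < η * β) :
    (zLaw p η β).prod (zLaw p η β) =
      (ENNReal.ofReal (η * β) • (volume : Measure (Space d × Space d))).withDensity
        fun z => ENNReal.ofReal (Real.exp (-(η * β * cZero p * powSum p z))) := by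
  have hm := measurable_zLaw_density p η β
  have hcont := continuous_powSum p
  rw [zLaw, prod_withDensity hm hm, ← Measure.volume_eq_prod, withDensity_smul_measure,
    ← withDensity_smul _ (by fun_prop)]
  congr 1
  ext z
  rw [Pi.smul_apply, smul_eq_mul, ← ENNReal.ofReal_mul (by positivity),
    ← ENNReal.ofReal_mul h.le]
  congr 1
  rw [mul_mul_mul_comm, Real.mul_self_sqrt h.le, ← Real.exp_add, powSum]
  congr 2
  ring

/-- The square of the total mass is the mass of the product measure, which becomes `∫ exp (-r) dr =
1` over `[0, ∞)` under `map_powSum`. -/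
lemma isProbabilityMeasure_zLaw (p : Seminorm ℝ (Space d)) (hp : ∀ x, p x = 0 → x = 0)
    (hd : d ≠ 0) {η β : ℝ} (h : 0 < η * β) : IsProbabilityMeasure (zLaw p η β) := by
  have h1 : ((zLaw p η β).prod (zLaw p η β)) Set.univ = 1 := by
    rw [zLaw_prod_zLaw p h, withDensity_apply _ MeasurableSet.univ, setLIntegral_univ]
    exact lintegral_exp_neg_of_map_eq ((continuous_powSum p).const_mul _).measurable
      (map_powSum p hp hd h)
  rw [← Set.univ_prod_univ, Measure.prod_prod] at h1
  refine ⟨?_⟩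
  rw [← sq] at h1
  exact (ENNReal.pow_right_strictMono two_ne_zero).injective (by simpa using h1)

/-- The Gaussian-type tail of the law of the rescaled end points. -/
lemma zLaw_tail (p : Seminorm ℝ (Space d)) (hp : ∀ x, p x = 0 → x = 0) (hd : d ≠ 0) {η β : ℝ}
    (h : 0 < η * β) {L : ℝ} (hL : 0 ≤ L) :
    zLaw p η β {z | L ≤ p z} ≤
      ENNReal.ofReal (√2 * Real.exp (-(η * β * cZero p / 2 * L ^ (2 * d)))) := by
  have hc := cZero_pos p hp hd
  have hprob := isProbabilityMeasure_zLaw p hp hd (η := η / 2) (β := β) (by linarith)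
  have hmeas : MeasurableSet {z | L ≤ p z} :=
    measurableSet_le measurable_const (continuous_seminorm p).measurable
  -- Half of the exponent yields the tail factor; the other half is, up to `√2`, the density of the
  -- law with `η / 2` in place of `η`, which is again a probability measure.
  have hsqrt : √(η * β) = √2 * √(η / 2 * β) := by
    rw [← Real.sqrt_mul (by norm_num)]
    congr 1
    ring
  calc zLaw p η β {z | L ≤ p z}
      = ∫⁻ z in {z | L ≤ p z},
        ENNReal.ofReal (√(η * β) * Real.exp (-(η * β * cZero p * p z ^ (2 * d)))) := by
        rw [zLaw, withDensity_apply _ hmeas]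
    _ ≤ ∫⁻ z in {z | L ≤ p z},
        ENNReal.ofReal (√2 * Real.exp (-(η * β * cZero p / 2 * L ^ (2 * d)))) *
        ENNReal.ofReal (√(η / 2 * β) *
          Real.exp (-(η / 2 * β * cZero p * p z ^ (2 * d)))) := by
        refine setLIntegral_mono' hmeas fun z (hz : L ≤ p z) => ?_
        rw [← ENNReal.ofReal_mul (by positivity)]
        refine ENNReal.ofReal_le_ofReal ?_
        rw [mul_mul_mul_comm, ← hsqrt, ← Real.exp_add]
        have := pow_le_pow_left₀ hL hz (2 * d)
        have := mul_le_mul_of_nonneg_left this (show 0 ≤ η * β * cZero p / 2 by positivity)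
        gcongr
        linarith
    _ = ENNReal.ofReal (√2 * Real.exp (-(η * β * cZero p / 2 * L ^ (2 * d)))) *
        zLaw p (η / 2) β {z | L ≤ p z} := by
        rw [lintegral_const_mul _ (measurable_zLaw_density p (η / 2) β), zLaw,
          withDensity_apply _ hmeas]
    _ ≤ _ := mul_le_of_le_one_right' prob_le_one

end Law

/-! ### The symmetrized edge process -/

/-- The measure `β |x - y|^{-s} dx dy` on `ℝ^d × ℝ^d`. -/
def symIntensity (p : Seminorm ℝ (Space d)) (s β : ℝ) : Measure (Space d × Space d) :=
  volume.withDensity fun z => ENNReal.ofReal (β / p (z.1 - z.2) ^ s)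

lemma measurable_edge_density (p : Seminorm ℝ (Space d)) (s β : ℝ) :
    Measurable fun z : Space d × Space d => ENNReal.ofReal (β / p (z.1 - z.2) ^ s) := by
  have := (continuous_seminorm p).measurable
  fun_prop

/-- Pairs of equal Euclidean norm carry no edges of either orientation under `intensity`; they are
negligible because spheres are null sets. -/
lemma volume_norm_eq_norm (hd : d ≠ 0) :
    ∀ᵐ z : Space d × Space d, ‖z.1‖ ≠ ‖z.2‖ := by
  have : NeZero d := ⟨hd⟩
  rw [ae_iff, Measure.volume_eq_prod]
  have hm : MeasurableSet {z : Space d × Space d | ¬ ‖z.1‖ ≠ ‖z.2‖} := by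
    simp only [ne_eq, not_not]
    exact measurableSet_eq_fun (by fun_prop) (by fun_prop)
  rw [Measure.measure_prod_null hm]
  refine Filter.Eventually.of_forall fun x => ?_
  change volume (Prod.mk x ⁻¹' _) = (0 : ℝ≥0∞)
  rw [← Measure.addHaar_sphere volume (0 : Space d) ‖x‖]
  congr 1
  ext y
  simp [eq_comm]

lemma measurePreserving_swap_space :
    MeasurePreserving (Prod.swap : Space d × Space d → Space d × Space d) := by
  rw [Measure.volume_eq_prod]
  exact Measure.measurePreserving_swap

lemma symIntensity_apply (p : Seminorm ℝ (Space d)) (s β : ℝ) (hd : d ≠ 0)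
    {B : Set (Space d × Space d)} (hB : MeasurableSet B) :
    symIntensity p s β B = intensity p s β B + intensity p s β (Prod.swap ⁻¹' B) := by
  have hf := measurable_edge_density p s β
  have hlt : MeasurableSet {z : Space d × Space d | ‖z.1‖ < ‖z.2‖} :=
    measurableSet_lt (by fun_prop) (by fun_prop)
  have h1 : Measurable fun z : Space d × Space d =>
      if ‖z.1‖ < ‖z.2‖ then ENNReal.ofReal (β / p (z.1 - z.2) ^ s) else 0 :=
    Measurable.ite hlt hf measurable_const
  have h1' : Measurable fun z : Space d × Space d =>
      if ‖z.2‖ < ‖z.1‖ then ENNReal.ofReal (β / p (z.1 - z.2) ^ s) else 0 :=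
    Measurable.ite (measurableSet_lt (by fun_prop) (by fun_prop)) hf measurable_const
  have h2 : ∫⁻ z in Prod.swap ⁻¹' B, (if ‖z.1‖ < ‖z.2‖ then
      ENNReal.ofReal (β / p (z.1 - z.2) ^ s) else 0) =
      ∫⁻ z in B, (if ‖z.2‖ < ‖z.1‖ then ENNReal.ofReal (β / p (z.1 - z.2) ^ s) else 0) := by
    rw [← measurePreserving_swap_space.setLIntegral_comp_preimage hB h1']
    simp only [Prod.fst_swap, Prod.snd_swap, map_sub_rev p]
  rw [symIntensity, intensity, withDensity_apply _ hB, withDensity_apply _ hB,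
    withDensity_apply _ (measurable_swap hB), h2, ← lintegral_add_left h1]
  refine lintegral_congr_ae (ae_restrict_of_ae ?_)
  filter_upwards [volume_norm_eq_norm hd] with z hz
  rcases lt_or_gt_of_ne hz with h | h
  · simp [h, h.not_gt]
  · simp [h, h.not_gt]

/-- The symmetric hull of a set of edges. -/
def hull (U : Set (Space d × Space d)) : Set (Space d × Space d) := U ∪ Prod.swap ⁻¹' U

lemma measurableSet_hull {U : Set (Space d × Space d)} (hU : MeasurableSet U) :
    MeasurableSet (hull U) := hU.union (measurable_swap hU)

lemma disjoint_sym_iff (S U : Set (Space d × Space d)) :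
    Disjoint (sym S) U ↔ Disjoint S (hull U) := by
  simp only [sym, hull, Set.disjoint_left, Set.mem_union, Set.mem_ofPred_eq, Set.mem_preimage]
  constructor
  · rintro h e he (h' | h')
    · exact h (Or.inl he) h'
    · exact h (a := e.swap) (Or.inr he) h'
  · rintro h e (he | he) h'
    · exact h he (Or.inl h')
    · exact h he (Or.inr h')

lemma hull_union (U V : Set (Space d × Space d)) : hull (U ∪ V) = hull U ∪ hull V := by
  ext e
  simp only [hull, Set.mem_union, Set.mem_preimage]
  tauto

lemma hull_mono {U V : Set (Space d × Space d)} (h : U ⊆ V) : hull U ⊆ hull V :=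
  Set.union_subset_union h (Set.preimage_mono h)

/-- Unlike `intensity`, the measure `symIntensity` is translation invariant; this identity transfers
the invariance to hulls. -/
lemma two_mul_intensity_hull (p : Seminorm ℝ (Space d)) (s β : ℝ) (hd : d ≠ 0)
    {U : Set (Space d × Space d)} (hU : MeasurableSet U) :
    2 * intensity p s β (hull U) = symIntensity p s β (hull U) := by
  rw [symIntensity_apply p s β hd (measurableSet_hull hU), two_mul]
  congr 2
  ext e
  simp only [hull, Set.mem_union, Set.mem_preimage, Prod.swap_swap]
  tauto

lemma intensity_hull_of_disjoint (p : Seminorm ℝ (Space d)) (s β : ℝ) (hd : d ≠ 0)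
    {U : Set (Space d × Space d)} (hU : MeasurableSet U) (h : Disjoint U (Prod.swap ⁻¹' U)) :
    intensity p s β (hull U) = symIntensity p s β U := by
  rw [symIntensity_apply p s β hd hU, hull, measure_union h (measurable_swap hU)]

/-- The simultaneous translation of both end points. -/
def shift (v : Space d) : (Space d × Space d) ≃ᵐ (Space d × Space d) :=
  MeasurableEquiv.addRight (v, v)

lemma symIntensity_shift (p : Seminorm ℝ (Space d)) (s β : ℝ) (v : Space d)
    {B : Set (Space d × Space d)} (hB : MeasurableSet B) :
    symIntensity p s β (shift v ⁻¹' B) = symIntensity p s β B := by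
  rw [symIntensity, withDensity_apply _ hB, withDensity_apply _ ((shift v).measurable hB)]
  have hmp : MeasurePreserving (shift v) := measurePreserving_add_right volume (v, v)
  rw [← hmp.setLIntegral_comp_preimage hB (measurable_edge_density p s β)]
  simp [shift]

lemma intensity_hull_shift (p : Seminorm ℝ (Space d)) (s β : ℝ) (hd : d ≠ 0) (v : Space d)
    {B : Set (Space d × Space d)} (hB : MeasurableSet B) :
    intensity p s β (hull (shift v ⁻¹' B)) = intensity p s β (hull B) := by
  have h1 := two_mul_intensity_hull p s β hd ((shift v).measurable hB)
  have h2 : hull (shift v ⁻¹' B) = shift v ⁻¹' hull B := rfl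
  rw [h2, symIntensity_shift p s β v (measurableSet_hull hB),
    ← two_mul_intensity_hull p s β hd hB] at h1
  rw [h2]
  exact (ENNReal.mul_right_inj two_ne_zero ENNReal.ofNat_ne_top).1 h1

/-! ### Void probabilities, independence and invariance of the symmetrized edges. -/

section SymmetricEdges

variable {Ω : Type*} [MeasurableSpace Ω] {P : Measure Ω} {S : Ω → Set (Space d × Space d)}
  {p : Seminorm ℝ (Space d)} {s β : ℝ}

/-- The symmetrized set of edges as a configuration. -/
def symConfig (S : Set (Space d × Space d)) : Config (Space d × Space d) := ⟨sym S⟩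

lemma IsPoissonProcess.measurable_symConfig (h : IsPoissonProcess S (intensity p s β) P) :
    Measurable fun ω => symConfig (S ω) :=
  measurable_union h.measurable ((measurable_preimage
    (MeasurableEquiv.prodComm (α := Space d) (β := Space d))).comp h.measurable)

/-- The symmetrized edges come in mirror pairs and do not form a Poisson process, but their void
probabilities are those of the original process on hulls, and these suffice. -/
lemma IsPoissonProcess.measure_disjoint_sym (h : IsPoissonProcess S (intensity p s β) P)
    {U : Set (Space d × Space d)} (hU : MeasurableSet U) :
    P {ω | Disjoint (sym (S ω)) U} = expNeg (intensity p s β (hull U)) := by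
  simp_rw [disjoint_sym_iff]
  exact h.measure_disjoint (measurableSet_hull hU)

lemma disjoint_restrict_iff {X : Type*} (A : Config X) (K U : Set X) :
    Disjoint (A.restrict K).points U ↔ Disjoint A.points (K ∩ U) := by
  simp only [Config.restrict, Set.disjoint_iff_inter_eq_empty, Set.inter_assoc]

/-- Disjoint hulls are required because an edge and its mirror image are present together. -/
lemma IsPoissonProcess.indepFun_restrict [IsProbabilityMeasure P]
    (h : IsPoissonProcess S (intensity p s β) P) {K K' : Set (Space d × Space d)}
    (hK : MeasurableSet K) (hK' : MeasurableSet K') (hd : Disjoint (hull K) (hull K')) :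
    IndepFun (fun ω => (symConfig (S ω)).restrict K) (fun ω => (symConfig (S ω)).restrict K')
      P := by
  refine indepFun_config ((measurable_restrict hK).comp h.measurable_symConfig)
    ((measurable_restrict hK').comp h.measurable_symConfig) fun U V hU hV => ?_
  simp only [disjoint_restrict_iff, symConfig, ← Set.disjoint_union_right]
  rw [h.measure_disjoint_sym (hK.inter hU), h.measure_disjoint_sym (hK'.inter hV),
    h.measure_disjoint_sym ((hK.inter hU).union (hK'.inter hV)), hull_union, measure_union,
    expNeg_add]
  · exact hd.mono (hull_mono Set.inter_subset_left) (hull_mono Set.inter_subset_left)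
  · exact measurableSet_hull (hK'.inter hV)

lemma IsPoissonProcess.map_restrict_eq [IsProbabilityMeasure P]
    {S' : Ω → Set (Space d × Space d)} (h : IsPoissonProcess S (intensity p s β) P)
    (h' : IsPoissonProcess S' (intensity p s β) P) {K : Set (Space d × Space d)}
    (hK : MeasurableSet K) :
    P.map (fun ω => (symConfig (S' ω)).restrict K) =
      P.map (fun ω => (symConfig (S ω)).restrict K) := by
  refine map_config_eq ((measurable_restrict hK).comp h'.measurable_symConfig)
    ((measurable_restrict hK).comp h.measurable_symConfig) fun U hU => ?_
  simp only [disjoint_restrict_iff, symConfig]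
  rw [h.measure_disjoint_sym (hK.inter hU), h'.measure_disjoint_sym (hK.inter hU)]

/-- The law of the symmetrized edges is invariant under translations. -/
lemma IsPoissonProcess.map_shift_eq [IsProbabilityMeasure P]
    (h : IsPoissonProcess S (intensity p s β) P) (hd : d ≠ 0) (v : Space d)
    {K : Set (Space d × Space d)} (hK : MeasurableSet K) :
    P.map (fun ω => ((symConfig (S ω)).restrict ((shift v).symm ⁻¹' K)).preimage (shift v)) =
      P.map (fun ω => (symConfig (S ω)).restrict K) := by
  have hK' := (shift v).symm.measurable hK
  refine map_config_eq ((measurable_preimage (shift v)).comp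
    ((measurable_restrict hK').comp h.measurable_symConfig))
    ((measurable_restrict hK).comp h.measurable_symConfig) fun U hU => ?_
  simp only [Config.preimage, disjoint_preimage_iff, disjoint_restrict_iff, symConfig,
    ← Set.preimage_inter]
  rw [h.measure_disjoint_sym (hK.inter hU),
    h.measure_disjoint_sym ((shift v).symm.measurable (hK.inter hU)),
    ← intensity_hull_shift p s β hd v ((shift v).symm.measurable (hK.inter hU)),
    ← Set.preimage_comp, MeasurableEquiv.symm_comp_self, Set.preimage_id]

end SymmetricEdges

/-! ### Comparison of intensities -/

/-- The rescaling `(z, z') ↦ (a z, x + b z')` of a pair of end points. -/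
def rescale {a b : ℝ} (ha : a ≠ 0) (hb : b ≠ 0) (x : Space d) :
    (Space d × Space d) ≃ᵐ (Space d × Space d) :=
  (MeasurableEquiv.smul₀ a ha).prodCongr
    ((MeasurableEquiv.smul₀ b hb).trans (MeasurableEquiv.addRight x))

lemma rescale_apply {a b : ℝ} (ha : a ≠ 0) (hb : b ≠ 0) (x : Space d) (z : Space d × Space d) :
    rescale ha hb x z = (a • z.1, b • z.2 + x) := rfl

lemma volume_rescale {a b : ℝ} (ha : 0 < a) (hb : 0 < b) (x : Space d)
    {U : Set (Space d × Space d)} (hU : MeasurableSet U) :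
    volume (rescale ha.ne' hb.ne' x ⁻¹' U) = ENNReal.ofReal ((a * b) ^ d)⁻¹ * volume U := by
  have h1 : (volume : Measure (Space d)).map (fun z => a • z) =
      ENNReal.ofReal (a ^ d)⁻¹ • volume := by
    rw [Measure.map_addHaar_smul _ ha.ne', finrank_euclideanSpace_fin, abs_of_pos (by positivity)]
  have h2 : (volume : Measure (Space d)).map (fun z => b • z + x) =
      ENNReal.ofReal (b ^ d)⁻¹ • volume := by
    have : (fun z : Space d => b • z + x) = (fun z => z + x) ∘ fun z => b • z := rfl
    rw [this, ← Measure.map_map (by fun_prop) (by fun_prop), Measure.map_addHaar_smul _ hb.ne',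
      finrank_euclideanSpace_fin, abs_of_pos (by positivity), Measure.map_smul,
      map_add_right_eq_self]
  rw [← Measure.map_apply (rescale ha.ne' hb.ne' x).measurable hU, Measure.volume_eq_prod]
  have h3 : (⇑(rescale ha.ne' hb.ne' x)) = Prod.map (fun z => a • z) fun z => b • z + x := rfl
  rw [h3, ← Measure.map_prod_map _ _ (by fun_prop) (by fun_prop), h1, h2,
    Measure.prod_smul_left, Measure.prod_smul_right, smul_smul, Measure.smul_apply, smul_eq_mul,
    ← ENNReal.ofReal_mul (by positivity), mul_pow, mul_inv]

/-- The rescaling has Jacobian `(ab)^d = D`, and on `U` the edge density `β |e₁ - e₂|^(-s)` is at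
least `ηβ / D`. -/
lemma volume_rescale_le_symIntensity (p : Seminorm ℝ (Space d)) {s β η a b D : ℝ} (hβ : 0 < β)
    (hη : 0 < η) (ha : 0 < a) (hb : 0 < b) (x : Space d) (hD : 0 < D)
    (hab : (a * b) ^ d = D) {U : Set (Space d × Space d)} (hU : MeasurableSet U)
    (h : ∀ e ∈ U, 0 < p (e.1 - e.2) ∧ η * p (e.1 - e.2) ^ s ≤ D) :
    ENNReal.ofReal (η * β) * volume (rescale ha.ne' hb.ne' x ⁻¹' U) ≤ symIntensity p s β U := by
  rw [volume_rescale ha hb x hU, ← mul_assoc, ← ENNReal.ofReal_mul (by positivity), hab,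
    symIntensity, withDensity_apply _ hU, ← setLIntegral_const]
  refine setLIntegral_mono' hU fun e he => ENNReal.ofReal_le_ofReal ?_
  obtain ⟨h1, h2⟩ := h e he
  have := Real.rpow_pos_of_pos h1 s
  rw [← div_eq_mul_inv, div_le_div_iff₀ hD this]
  nlinarith

/-! ### Comparison of the restricted distances -/

lemma map_pairs_eq_prod {Ω : Type*} {m₀ m₁ m₂ m₃ mΩ : MeasurableSpace Ω}
    {P : Measure Ω} [IsProbabilityMeasure P] (h₀ : m₀ ≤ mΩ) (h₁ : m₁ ≤ mΩ)
    (h₂ : m₂ ≤ mΩ) (h₃ : m₃ ≤ mΩ) (hI : iIndep ![m₀, m₁, m₂, m₃] P)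
    {E F : Type*} [MeasurableSpace E] [MeasurableSpace F] {f₀ f₁ : Ω → E} {f₂ f₃ : Ω → F}
    (hf₀ : Measurable[m₀] f₀) (hf₁ : Measurable[m₁] f₁) (hf₂ : Measurable[m₂] f₂)
    (hf₃ : Measurable[m₃] f₃) :
    P.map (fun ω => ((f₀ ω, f₁ ω), (f₂ ω, f₃ ω))) =
      ((P.map f₀).prod (P.map f₁)).prod ((P.map f₂).prod (P.map f₃)) := by
  have hle : ∀ i, ![m₀, m₁, m₂, m₃] i ≤ mΩ := by
    intro i
    fin_cases i <;> assumption
  have g₀ : Measurable f₀ := hf₀.mono h₀ le_rfl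
  have g₁ : Measurable f₁ := hf₁.mono h₁ le_rfl
  have g₂ : Measurable f₂ := hf₂.mono h₂ le_rfl
  have g₃ : Measurable f₃ := hf₃.mono h₃ le_rfl
  have h01 : IndepFun f₀ f₁ P := indep_of_indep_of_le_left (indep_of_indep_of_le_right
    (hI.indep (show (0 : Fin 4) ≠ 1 by decide)) hf₁.comap_le) hf₀.comap_le
  have h23 : IndepFun f₂ f₃ P := indep_of_indep_of_le_left (indep_of_indep_of_le_right
    (hI.indep (show (2 : Fin 4) ≠ 3 by decide)) hf₃.comap_le) hf₂.comap_le
  have hpair : IndepFun (fun ω => (f₀ ω, f₁ ω)) (fun ω => (f₂ ω, f₃ ω)) P := by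
    have h := indep_iSup_of_disjoint hle hI (S := {0, 1}) (T := {2, 3}) (by
      rw [Set.disjoint_left]
      intro i
      fin_cases i <;> simp)
    refine indep_of_indep_of_le_left (indep_of_indep_of_le_right h ?_) ?_
    · refine Measurable.comap_le (Measurable.prodMk ?_ ?_)
      · exact hf₂.mono (le_iSup₂_of_le 2 (by simp) le_rfl) le_rfl
      · exact hf₃.mono (le_iSup₂_of_le 3 (by simp) le_rfl) le_rfl
    · refine Measurable.comap_le (Measurable.prodMk ?_ ?_)
      · exact hf₀.mono (le_iSup₂_of_le 0 (by simp) le_rfl) le_rfl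
      · exact hf₁.mono (le_iSup₂_of_le 1 (by simp) le_rfl) le_rfl
  rw [(indepFun_iff_map_prod_eq_prod_map_map (g₀.prodMk g₁).aemeasurable
      (g₂.prodMk g₃).aemeasurable).1 hpair,
    (indepFun_iff_map_prod_eq_prod_map_map g₀.aemeasurable g₁.aemeasurable).1 h01,
    (indepFun_iff_map_prod_eq_prod_map_map g₂.aemeasurable g₃.aemeasurable).1 h23]

lemma restrictedDist_anti (p : Seminorm ℝ (Space d)) {S T : Set (Space d × Space d)}
    (h : S ⊆ T) (x y : Space d) : restrictedDist p T x y ≤ restrictedDist p S x y := by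
  refine le_of_forall_gt fun t ht => ?_
  obtain ⟨l, hl, hlt⟩ := (restrictedDist_lt_iff p S x y t).1 ht
  exact (restrictedDist_lt_iff p T x y t).2
    ⟨l, fun e he => ⟨sym_mono h (hl e he).1, (hl e he).2⟩, hlt⟩

/-- The edges with both end points in the ball of radius `r` around the origin. -/
def localEdges (p : Seminorm ℝ (Space d)) (r : ℝ) : Set (Space d × Space d) :=
  {e | p e.1 < r ∧ p e.2 < r}

lemma measurableSet_localEdges (p : Seminorm ℝ (Space d)) (r : ℝ) :
    MeasurableSet (localEdges p r) := by
  have := (continuous_seminorm p).measurable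
  exact (measurableSet_lt (this.comp measurable_fst) measurable_const).inter
    (measurableSet_lt (this.comp measurable_snd) measurable_const)

/-! ### Disjointness of the edge regions around `0`, around `x` and between the two. -/

section Geometry

variable {p : Seminorm ℝ (Space d)} {x : Space d} {a b r L : ℝ}

lemma mem_shift_localEdges {e : Space d × Space d} :
    e ∈ (shift x).symm ⁻¹' localEdges p r ↔ p (e.1 - x) < r ∧ p (e.2 - x) < r := by
  simp only [sub_eq_add_neg]
  rfl

lemma near_rescale (ha : 0 < a) (hb : 0 < b) (haL : a * L ≤ r) (hbL : b * L ≤ r)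
    {e : Space d × Space d} (he : e ∈ (rescale ha.ne' hb.ne' x).symm ⁻¹' localEdges p L) :
    p e.1 < r ∧ p (e.2 - x) < r := by
  obtain ⟨z, rfl⟩ := (rescale ha.ne' hb.ne' x).surjective e
  rw [Set.mem_preimage, MeasurableEquiv.symm_apply_apply] at he
  rw [rescale_apply, add_sub_cancel_right, map_smul_eq_mul, map_smul_eq_mul, Real.norm_of_nonneg
    ha.le, Real.norm_of_nonneg hb.le]
  exact ⟨(mul_lt_mul_of_pos_left he.1 ha).trans_le haL,
    (mul_lt_mul_of_pos_left he.2 hb).trans_le hbL⟩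

lemma not_near_both (h : 4 * r ≤ p x) {y : Space d} (h1 : p y < 2 * r) (h2 : p (y - x) < 2 * r) :
    False := by
  have := map_sub_le_add p y (y - x)
  rw [sub_sub_cancel] at this
  linarith

lemma disjoint_hull_local_shift (h : 4 * r ≤ p x) :
    Disjoint (hull (localEdges p (2 * r)))
      (hull ((shift x).symm ⁻¹' localEdges p (2 * r))) := by
  rw [Set.disjoint_left]
  intro e he he'
  simp only [hull, Set.mem_union, Set.mem_preimage (f := Prod.swap), mem_shift_localEdges,
    Prod.fst_swap, Prod.snd_swap] at he'
  have h1 : p e.1 < 2 * r := by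
    rcases he with he | he
    · exact he.1
    · exact he.2
  have h2 : p (e.1 - x) < 2 * r := by
    rcases he' with he' | he'
    · exact he'.1
    · exact he'.2
  exact not_near_both h h1 h2

/-- A local edge has both ends near the same one of `0` and `x`; a joining edge has one end near
each. -/
lemma disjoint_hull_local_rescale (ha : 0 < a) (hb : 0 < b) (hr : 0 < r) (haL : a * L ≤ r)
    (hbL : b * L ≤ r) (h : 4 * r ≤ p x) :
    Disjoint (hull (localEdges p (2 * r) ∪ (shift x).symm ⁻¹' localEdges p (2 * r)))
      (hull ((rescale ha.ne' hb.ne' x).symm ⁻¹' localEdges p L)) := by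
  rw [Set.disjoint_left]
  intro e he he'
  simp only [hull, Set.mem_union, Set.mem_preimage (f := Prod.swap), mem_shift_localEdges,
    Prod.fst_swap, Prod.snd_swap] at he
  have h1 : (p e.1 < 2 * r ∧ p e.2 < 2 * r) ∨ (p (e.1 - x) < 2 * r ∧ p (e.2 - x) < 2 * r) := by
    rcases he with (he | he) | (he | he)
    · exact Or.inl he
    · exact Or.inr he
    · exact Or.inl he.symm
    · exact Or.inr he.symm
  have h2 : (p e.1 < r ∧ p (e.2 - x) < r) ∨ (p e.2 < r ∧ p (e.1 - x) < r) := by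
    rcases he' with he' | he'
    · exact Or.inl (near_rescale ha hb haL hbL he')
    · exact Or.inr (near_rescale ha hb haL hbL he')
  rcases h1 with h1 | h1 <;> rcases h2 with h2 | h2
  · exact not_near_both h h1.2 (by linarith)
  · exact not_near_both h h1.1 (by linarith)
  · exact not_near_both h (by linarith) h1.1
  · exact not_near_both h (by linarith) h1.2

/-- Joining edges are oriented from `0` to `x`, so no mirror pair is counted twice and the void
probability is governed by the full `symIntensity`. -/
lemma disjoint_rescale_swap (ha : 0 < a) (hb : 0 < b) (hr : 0 < r) (haL : a * L ≤ r)
    (hbL : b * L ≤ r) (h : 4 * r ≤ p x) :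
    Disjoint ((rescale ha.ne' hb.ne' x).symm ⁻¹' localEdges p L)
      (Prod.swap ⁻¹' ((rescale ha.ne' hb.ne' x).symm ⁻¹' localEdges p L)) := by
  rw [Set.disjoint_left]
  intro e he he'
  have h1 := near_rescale ha hb haL hbL he
  have h2 := near_rescale ha hb haL hbL he'
  exact not_near_both h (y := e.1) (by linarith [h1.1]) (by linarith [show p (e.1 - x) < r from h2.2])

end Geometry

/-! ### Replacing the independent pair by the ends of a joining edge. -/

section Comparison

variable {Ω : Type*} [MeasurableSpace Ω] {P : Measure Ω} [IsProbabilityMeasure P]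
  {S : Ω → Set (Space d × Space d)} {p : Seminorm ℝ (Space d)} {s β η : ℝ}
  {x : Space d} {a b r L : ℝ}

/-- The pairs `(z, z')` near the origin for which the paths from `0` to `a z` and from `0`
to `b z'` have total length less than `t - 1`. -/
def shortPairs (p : Seminorm ℝ (Space d)) (a b L t : ℝ)
    (q : Config (Space d × Space d) × Config (Space d × Space d)) : Set (Space d × Space d) :=
  {z | z ∈ localEdges p L ∧ restrictedDist p q.1.points 0 (a • z.1) +
    restrictedDist p q.2.points 0 (b • z.2) + 1 < t}

lemma measurableSet_shortPairs_graph (p : Seminorm ℝ (Space d)) (a b L t : ℝ) :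
    MeasurableSet {q : (Config (Space d × Space d) × Config (Space d × Space d)) ×
      (Space d × Space d) | q.2 ∈ shortPairs p a b L t q.1} := by
  have h₁ := measurable_restrictedDist_comp p (w := fun q : (Config (Space d × Space d) ×
    Config (Space d × Space d)) × (Space d × Space d) => a • q.2.1) (S := fun q => q.1.1.points)
    (measurable_fst.comp measurable_fst) (by fun_prop)
  have h₂ := measurable_restrictedDist_comp p (w := fun q : (Config (Space d × Space d) ×
    Config (Space d × Space d)) × (Space d × Space d) => b • q.2.2) (S := fun q => q.1.2.points)
    (measurable_snd.comp measurable_fst) (by fun_prop)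
  exact (measurable_snd (measurableSet_localEdges p L)).inter
    (measurableSet_lt ((h₁.add h₂).add_const 1) measurable_const)

lemma measurableSet_shortPairs (p : Seminorm ℝ (Space d)) (a b L t : ℝ)
    (q : Config (Space d × Space d) × Config (Space d × Space d)) :
    MeasurableSet (shortPairs p a b L t q) :=
  measurable_prodMk_left (measurableSet_shortPairs_graph p a b L t)

/-- The probability that some edge has its rescaled end points in `W` is at least the probability
that the pair of independent variables is in `W`. -/
lemma prod_zLaw_le_measure_hit (hp : ∀ x, p x = 0 → x = 0) (hd : d ≠ 0) (hβ : 0 < β)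
    (hη : 0 < η) (hs : 0 < s) (ha : 0 < a) (hb : 0 < b) (hr : 0 < r) (haL : a * L ≤ r)
    (hbL : b * L ≤ r) (h4 : 4 * r ≤ p x) (hab : (a * b) ^ d = p x ^ s)
    (hηs : η * (p x + 2 * r) ^ s ≤ p x ^ s) (h : IsPoissonProcess S (intensity p s β) P)
    {W : Set (Space d × Space d)} (hW : MeasurableSet W) (hWL : W ⊆ localEdges p L) :
    (zLaw p η β).prod (zLaw p η β) W ≤
      P {ω | ¬ Disjoint (sym (S ω)) ((rescale ha.ne' hb.ne' x).symm ⁻¹' W)} := by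
  have hηβ : 0 < η * β := mul_pos hη hβ
  have hx : 0 < p x := by linarith
  set U := (rescale ha.ne' hb.ne' x).symm ⁻¹' W with hU
  have hUm : MeasurableSet U := (rescale ha.ne' hb.ne' x).symm.measurable hW
  have hUL : U ⊆ (rescale ha.ne' hb.ne' x).symm ⁻¹' localEdges p L := Set.preimage_mono hWL
  have hUsym : Disjoint U (Prod.swap ⁻¹' U) :=
    (disjoint_rescale_swap ha hb hr haL hbL h4).mono hUL (Set.preimage_mono hUL)
  have hUW : rescale ha.ne' hb.ne' x ⁻¹' U = W := by
    rw [hU, ← Set.preimage_comp, MeasurableEquiv.symm_comp_self, Set.preimage_id]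
  have hlower : ENNReal.ofReal (η * β) * volume W ≤ symIntensity p s β U := by
    rw [← hUW]
    refine volume_rescale_le_symIntensity p hβ hη ha hb x (Real.rpow_pos_of_pos hx s) hab hUm
      fun e he => ?_
    obtain ⟨h1, h2⟩ := near_rescale ha hb haL hbL (hUL he)
    -- The length of a joining edge lies between `|x| - 2r > 0` and `|x| + 2r`.
    have e1 : p x ≤ p e.1 + p (e.1 - e.2) + p (e.2 - x) := by
      have h3 := map_sub_le_add p e.1 (e.1 - x)
      have h4 := map_add_le_add p (e.1 - e.2) (e.2 - x)
      rw [sub_sub_cancel] at h3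
      rw [sub_add_sub_cancel] at h4
      linarith
    have e2 : p (e.1 - e.2) ≤ p e.1 + p (e.2 - x) + p x := by
      have h3 := map_sub_le_add p e.1 e.2
      have h4 := map_add_le_add p (e.2 - x) x
      rw [sub_add_cancel] at h4
      linarith
    refine ⟨by linarith, le_trans ?_ hηs⟩
    have := apply_nonneg p (e.1 - e.2)
    gcongr
    linarith
  have hmeas : MeasurableSet {ω | Disjoint (sym (S ω)) U} :=
    h.measurable_symConfig (measurableSet_void hUm)
  have hcompl : {ω | ¬ Disjoint (sym (S ω)) U} = {ω | Disjoint (sym (S ω)) U}ᶜ := rfl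
  rw [hcompl, prob_compl_eq_one_sub hmeas, h.measure_disjoint_sym hUm,
    intensity_hull_of_disjoint p s β hd hUm hUsym, zLaw_prod_zLaw p hηβ, withDensity_apply _ hW]
  refine (setLIntegral_exp_neg_le ((continuous_powSum p).const_mul _).measurable
    (map_powSum p hp hd hηβ) W).trans ?_
  exact tsub_le_tsub_left (expNeg_anti hlower) 1

/-- The comparison of the two distances as long as the rescaled end points are not too far from
the origin. -/
lemma measure_shortPairs_le (hp : ∀ x, p x = 0 → x = 0) (hd : d ≠ 0) (hβ : 0 < β)
    (hη : 0 < η) (hs : 0 < s) (ha : 0 < a) (hb : 0 < b) (hr : 0 < r) (haL : a * L ≤ r)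
    (hbL : b * L ≤ r) (h4 : 4 * r ≤ p x) (hab : (a * b) ^ d = p x ^ s)
    (hηs : η * (p x + 2 * r) ^ s ≤ p x ^ s) {S' : Ω → Set (Space d × Space d)}
    {Z Z' : Ω → Space d} (h : IsPoissonProcess S (intensity p s β) P)
    (h' : IsPoissonProcess S' (intensity p s β) P) (hZ : Measurable Z)
    (hZlaw : P.map Z = zLaw p η β) (hZ' : Measurable Z') (hZlaw' : P.map Z' = zLaw p η β)
    (hI : iIndep ![pointSigma S, pointSigma S', MeasurableSpace.comap Z inferInstance,
      MeasurableSpace.comap Z' inferInstance] P) (t : ℝ) :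
    P {ω | (Z ω, Z' ω) ∈ shortPairs p a b L t (⟨S ω⟩, ⟨S' ω⟩)} ≤
      P {ω | restrictedDist p (S ω) 0 x < t} := by
  have hx : 0 < p x := by linarith
  set K := localEdges p (2 * r) with hKdef
  have hK : MeasurableSet K := measurableSet_localEdges p (2 * r)
  set K₂ := (shift x).symm ⁻¹' K with hK₂def
  have hK₂ : MeasurableSet K₂ := (shift x).symm.measurable hK
  set R := (rescale ha.ne' hb.ne' x).symm ⁻¹' localEdges p L with hRdef
  have hR : MeasurableSet R :=
    (rescale ha.ne' hb.ne' x).symm.measurable (measurableSet_localEdges p L)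
  -- `T₁`: edges near `0`; `T₁'`: the same for the copy; `T₂`: edges near `x`, moved to the origin;
  -- `T₃`: joining edges. The pairs `(T₁, T₁')` and `(T₁, T₂)` have the same law.
  let T₁ : Ω → Config (Space d × Space d) := fun ω => (symConfig (S ω)).restrict K
  let T₁' : Ω → Config (Space d × Space d) := fun ω => (symConfig (S' ω)).restrict K
  let T₂ : Ω → Config (Space d × Space d) :=
    fun ω => ((symConfig (S ω)).restrict K₂).preimage (shift x)
  let T₃ : Ω → Config (Space d × Space d) := fun ω => (symConfig (S ω)).restrict R
  have hT₁ : Measurable T₁ := (measurable_restrict hK).comp h.measurable_symConfig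
  have hT₁' : Measurable T₁' := (measurable_restrict hK).comp h'.measurable_symConfig
  have hT₂ : Measurable T₂ :=
    (measurable_preimage _).comp ((measurable_restrict hK₂).comp h.measurable_symConfig)
  have hT₃ : Measurable T₃ := (measurable_restrict hR).comp h.measurable_symConfig
  set π₁ := P.map T₁ with hπ₁
  have : IsProbabilityMeasure π₁ := Measure.isProbabilityMeasure_map hT₁.aemeasurable
  have : IsProbabilityMeasure (P.map T₃) := Measure.isProbabilityMeasure_map hT₃.aemeasurable
  have hT₂law : P.map T₂ = π₁ := h.map_shift_eq hd x hK
  have hT₁'law : P.map T₁' = π₁ := h.map_restrict_eq h' hK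
  have h12 : IndepFun T₁ T₂ P :=
    (h.indepFun_restrict hK hK₂ (disjoint_hull_local_shift h4)).comp measurable_id
      (measurable_preimage (shift x))
  have h123 : IndepFun (fun ω => (T₁ ω, T₂ ω)) T₃ P := by
    have := (h.indepFun_restrict (hK.union hK₂) hR
      (disjoint_hull_local_rescale ha hb hr haL hbL h4)).comp
      (φ := fun A => (A.restrict K, (A.restrict K₂).preimage (shift x))) (ψ := id)
      ((measurable_restrict hK).prodMk
        ((measurable_preimage (shift x)).comp (measurable_restrict hK₂))) measurable_id
    convert this using 1
    swap
    · rfl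
    ext ω : 1
    simp only [Function.comp, T₁, T₂, Config.restrict, Set.inter_assoc,
      Set.union_inter_cancel_left, Set.union_inter_cancel_right]
  have hlaw : P.map (fun ω => ((T₁ ω, T₂ ω), T₃ ω)) = (π₁.prod π₁).prod (P.map T₃) := by
    rw [(indepFun_iff_map_prod_eq_prod_map_map (hT₁.prodMk hT₂).aemeasurable
      hT₃.aemeasurable).1 h123, (indepFun_iff_map_prod_eq_prod_map_map hT₁.aemeasurable
      hT₂.aemeasurable).1 h12, hT₂law]
  have hlaw' : P.map (fun ω => ((T₁ ω, T₁' ω), (Z ω, Z' ω))) =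
      (π₁.prod π₁).prod ((zLaw p η β).prod (zLaw p η β)) := by
    have hm : ∀ S : Ω → Set (Space d × Space d), Measurable[pointSigma S]
        fun ω => (symConfig (S ω)).restrict K := by
      intro S
      let := pointSigma S
      have hS : Measurable fun ω => (⟨S ω⟩ : Config (Space d × Space d)) :=
        measurable_config_pointSigma S
      exact (measurable_restrict hK).comp (measurable_union hS ((measurable_preimage
        (MeasurableEquiv.prodComm (α := Space d) (β := Space d))).comp hS))
    rw [map_pairs_eq_prod h.pointSigma_le h'.pointSigma_le hZ.comap_le hZ'.comap_le hI (hm S)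
      (hm S') (comap_measurable Z) (comap_measurable Z'), hZlaw, hZlaw']
    change (π₁.prod (P.map T₁')).prod _ = _
    rw [hT₁'law]
  -- The edges moved to the origin are put back near `x`. On the actual edges this yields a subset
  -- of `sym S`, so its restricted distance can only be larger.
  let joined : (Config (Space d × Space d) × Config (Space d × Space d)) ×
      Config (Space d × Space d) → Config (Space d × Space d) := fun q =>
    (q.1.1.union (q.1.2.preimage (shift x).symm)).union q.2
  have hjoined : Measurable joined :=
    measurable_union (measurable_union (by fun_prop)
      ((measurable_preimage (shift x).symm).comp (by fun_prop))) measurable_snd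
  set Q := {q | restrictedDist p (joined q).points 0 x < t} with hQdef
  have hQ : MeasurableSet Q := measurableSet_lt
    (measurable_restrictedDist_comp p hjoined measurable_const) measurable_const
  calc P {ω | (Z ω, Z' ω) ∈ shortPairs p a b L t (⟨S ω⟩, ⟨S' ω⟩)}
      ≤ P.map (fun ω => ((T₁ ω, T₁' ω), (Z ω, Z' ω)))
          {q | q.2 ∈ shortPairs p a b L t q.1} := by
        rw [Measure.map_apply ((hT₁.prodMk hT₁').prodMk (hZ.prodMk hZ'))
          (measurableSet_shortPairs_graph p a b L t)]
        refine measure_mono fun ω hω => ?_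
        obtain ⟨⟨hz, hz'⟩, hlt⟩ := hω
        refine ⟨⟨hz, hz'⟩, ?_⟩
        have hu : p (a • Z ω) ≤ r := by
          rw [map_smul_eq_mul, Real.norm_of_nonneg ha.le]
          exact (mul_le_mul_of_nonneg_left hz.le ha.le).trans haL
        have hw : p (b • Z' ω) ≤ r := by
          rw [map_smul_eq_mul, Real.norm_of_nonneg hb.le]
          exact (mul_le_mul_of_nonneg_left hz'.le hb.le).trans hbL
        -- Discarding the edges outside the ball of radius `2r` does not change the two distances.
        have e1 := restrictedDist_inter p (sym (S ω)) hu
        have e2 := restrictedDist_inter p (sym (S' ω)) hw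
        rw [restrictedDist_sym] at e1 e2
        change restrictedDist p (sym (S ω) ∩ _) 0 (a • Z ω) +
          restrictedDist p (sym (S' ω) ∩ _) 0 (b • Z' ω) + 1 < t
        rw [hKdef, localEdges, e1, e2]
        exact hlt
    _ = ∫⁻ q, (zLaw p η β).prod (zLaw p η β) (shortPairs p a b L t q) ∂(π₁.prod π₁) := by
        rw [hlaw', Measure.prod_apply (measurableSet_shortPairs_graph p a b L t)]
        rfl
    -- The local configurations `q` are now frozen: `T₃` is independent of them, and any joining
    -- edge with rescaled ends in `shortPairs` completes a path shorter than `t`.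
    _ ≤ ∫⁻ q, P.map T₃ (Prod.mk q ⁻¹' Q) ∂(π₁.prod π₁) := by
        refine lintegral_mono fun q => ?_
        refine (prod_zLaw_le_measure_hit hp hd hβ hη hs ha hb hr haL hbL h4 hab hηs h
          (measurableSet_shortPairs p a b L t q) fun z hz => hz.1).trans ?_
        rw [Measure.map_apply hT₃ (measurable_prodMk_left hQ)]
        refine measure_mono fun ω hω => ?_
        obtain ⟨e, he, heW⟩ := Set.not_disjoint_iff.1 hω
        obtain ⟨z, rfl⟩ := (rescale ha.ne' hb.ne' x).surjective e
        rw [Set.mem_preimage, MeasurableEquiv.symm_apply_apply] at heW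
        obtain ⟨hzL, hlt⟩ := heW
        have hzR : rescale ha.ne' hb.ne' x z ∈ R := by
          rw [hRdef, Set.mem_preimage, MeasurableEquiv.symm_apply_apply]
          exact hzL
        have hnear := near_rescale ha hb haL hbL hzR
        rw [rescale_apply, add_sub_cancel_right] at hnear
        dsimp only at hnear
        change restrictedDist p (joined (q, T₃ ω)).points 0 x < t
        refine restrictedDist_concat_lt (u := a • z.1) (w := b • z.2) p (by linarith)
          (by linarith) (fun e he => Or.inl (Or.inl he)) (fun e he => Or.inl (Or.inr ?_))
          (Or.inr ⟨he, hzR⟩) hlt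
        change (shift x).symm (shift x e) ∈ q.2.points
        rwa [MeasurableEquiv.symm_apply_apply]
    _ = P.map (fun ω => ((T₁ ω, T₂ ω), T₃ ω)) Q := by
        rw [hlaw, Measure.prod_apply hQ]
    _ ≤ P {ω | restrictedDist p (S ω) 0 x < t} := by
        rw [Measure.map_apply ((hT₁.prodMk hT₂).prodMk hT₃) hQ]
        refine measure_mono fun ω (hω : restrictedDist p _ 0 x < t) => ?_
        refine lt_of_le_of_lt ?_ hω
        rw [← restrictedDist_sym]
        refine restrictedDist_anti p ?_ 0 x
        rintro e ((he | he) | he)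
        · exact he.1
        · have := he.1
          change shift x ((shift x).symm e) ∈ sym (S ω) at this
          rwa [MeasurableEquiv.apply_symm_apply] at this
        · exact he.1

end Comparison

/-! ### Assembly -/

/-- Complements give the comparison of `{u ≤ X}` and `{u ≤ Y}`; the strict version follows by
letting `u` decrease to `t`. Strict upper bounds are what concatenating near-optimal paths provides.
-/
lemma stochLE_of_measure_lt_le {Ω : Type*} [MeasurableSpace Ω] {P : Measure Ω}
    [IsProbabilityMeasure P] {X Y : Ω → ℝ} (hX : Measurable X) (hY : Measurable Y)
    (h : ∀ t, P {ω | Y ω < t} ≤ P {ω | X ω < t}) : StochLE P X Y := by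
  refine ⟨hX.aemeasurable, hY.aemeasurable, fun t => ?_⟩
  have hge : ∀ u, P {ω | u ≤ X ω} ≤ P {ω | u ≤ Y ω} := by
    intro u
    have e : ∀ V : Ω → ℝ, {ω | u ≤ V ω} = {ω | V ω < u}ᶜ := by
      intro V
      ext ω
      simp
    rw [e X, e Y, prob_compl_eq_one_sub (measurableSet_lt hX measurable_const),
      prob_compl_eq_one_sub (measurableSet_lt hY measurable_const)]
    exact tsub_le_tsub_left (h u) 1
  have e : {ω | t < X ω} = ⋃ n : ℕ, {ω | t + 1 / ((n : ℝ) + 1) ≤ X ω} := by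
    ext ω
    simp only [Set.mem_iUnion, Set.mem_ofPred_eq]
    constructor
    · intro hω
      obtain ⟨n, hn⟩ := exists_nat_one_div_lt (sub_pos.2 hω)
      exact ⟨n, by linarith⟩
    · rintro ⟨n, hn⟩
      have : (0 : ℝ) < 1 / ((n : ℝ) + 1) := by positivity
      linarith
  have hmono : Monotone fun n : ℕ => {ω | t + 1 / ((n : ℝ) + 1) ≤ X ω} := by
    intro m n hmn ω (hω : t + 1 / ((m : ℝ) + 1) ≤ X ω)
    refine le_trans (add_le_add_right ?_ t) hω
    gcongr
  rw [e, hmono.measure_iUnion]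
  refine iSup_le fun n => (hge _).trans (measure_mono fun ω (hω : _ ≤ Y ω) => ?_)
  have : (0 : ℝ) < 1 / ((n : ℝ) + 1) := by positivity
  change t < Y ω
  linarith

/-- With `u = y^(-(1-γ)/2)`, which tends to `0`, the claims become `4u ≤ 1` and `η (1 + 2u)^s ≤ 1`;
at `u = 0` both are strict because `η < 1`. -/
lemma exists_threshold {η γ s : ℝ} (hη : η < 1) (hγ : γ < 1) :
    ∃ y₀ : ℝ, 1 ≤ y₀ ∧ ∀ y, y₀ ≤ y → 4 * y ^ ((1 + γ) / 2) ≤ y ∧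
      η * (y + 2 * y ^ ((1 + γ) / 2)) ^ s ≤ y ^ s := by
  have h0 : Filter.Tendsto (fun y : ℝ => y ^ (-((1 - γ) / 2))) Filter.atTop (nhds 0) :=
    tendsto_rpow_neg_atTop (by linarith)
  have hc : ContinuousAt (fun u : ℝ => η * (1 + 2 * u) ^ s) 0 := by
    refine continuousAt_const.mul (ContinuousAt.rpow_const (by fun_prop) (Or.inl (by norm_num)))
  have h1 := (hc.tendsto.comp h0).eventually_lt_const (u := 1) (by simpa using hη)
  have h2 := h0.eventually_lt_const (u := 1 / 4) (by norm_num)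
  obtain ⟨y₀, hy₀⟩ := Filter.eventually_atTop.1 (h1.and h2)
  refine ⟨max 1 y₀, le_max_left _ _, fun y hy => ?_⟩
  have hy1 : 1 ≤ y := (le_max_left _ _).trans hy
  have hy0 : 0 < y := by linarith
  obtain ⟨g1, g2⟩ := hy₀ y ((le_max_right _ _).trans hy)
  have e : y ^ ((1 + γ) / 2) = y * y ^ (-((1 - γ) / 2)) := by
    nth_rewrite 2 [← Real.rpow_one y]
    rw [← Real.rpow_add hy0]
    congr 1
    ring
  have hu : 0 < y ^ (-((1 - γ) / 2)) := Real.rpow_pos_of_pos hy0 _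
  simp only [Function.comp] at g1
  constructor
  · rw [e]
    nlinarith
  · have e2 : y + 2 * y ^ ((1 + γ) / 2) = y * (1 + 2 * y ^ (-((1 - γ) / 2))) := by
      rw [e]
      ring
    rw [e2, Real.mul_rpow hy0.le (by positivity), mul_left_comm]
    exact mul_le_of_le_one_right (Real.rpow_nonneg hy0.le s) g1.le

end LongRange

end

/-! ### The proposition: choice of constants and of the exceptional event. -/

theorem proposition2p7 {d : ℕ} (p : Seminorm ℝ (LongRange.Space d))
    (hp : ∀ x, p x = 0 → x = 0) (s β η γ γ₁ γ₂ θ : ℝ)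
    (hs₁ : (d : ℝ) < s) (hs₂ : s < 2 * d) (hβ : 0 < β) (hη₀ : 0 < η) (hη₁ : η < 1)
    (hγ : γ = s / (2 * d))
    (hγ₁ : 0 < γ₁) (hγ₁' : γ₁ < (1 + γ) / 2) (hγ₂ : 0 < γ₂) (hγ₂' : γ₂ < (1 + γ) / 2)
    (hsum : γ₁ + γ₂ = 2 * γ) (hθ : θ = 2 * d * ((1 + γ) / 2 - max γ₁ γ₂)) :
    IsProbabilityMeasure (LongRange.zLaw p η β) ∧
    ∃ c₁ c₂ : ℝ, 0 < c₁ ∧ 0 < c₂ ∧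
      ∀ (Ω : Type*) [MeasurableSpace Ω] (P : Measure Ω) [IsProbabilityMeasure P]
        (S S' : Ω → Set (LongRange.Space d × LongRange.Space d))
        (Z Z' : Ω → LongRange.Space d),
        LongRange.IsPoissonProcess S (LongRange.intensity p s β) P →
        LongRange.IsPoissonProcess S' (LongRange.intensity p s β) P →
        Measurable Z → P.map Z = LongRange.zLaw p η β →
        Measurable Z' → P.map Z' = LongRange.zLaw p η β →
        iIndep ![LongRange.pointSigma S, LongRange.pointSigma S',
          MeasurableSpace.comap Z inferInstance, MeasurableSpace.comap Z' inferInstance] P →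
        ∀ x : LongRange.Space d, ∃ A : Set Ω,
          MeasurableSet[MeasurableSpace.comap (fun ω => (Z ω, Z' ω)) inferInstance] A ∧
          P.real A ≤ c₁ * Real.exp (-(c₂ * p x ^ θ)) ∧
          LongRange.StochLE P
            (fun ω => LongRange.restrictedDist p (S ω) 0 x)
            (fun ω => LongRange.restrictedDist p (S ω) 0 (p x ^ γ₁ • Z ω) +
              LongRange.restrictedDist p (S' ω) 0 (p x ^ γ₂ • Z' ω) + 1 +
              p x * A.indicator (fun _ => (1 : ℝ)) ω) := by
  have hd : d ≠ 0 := by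
    rintro rfl
    norm_num at hs₁ hs₂
    linarith
  have hd0 : (0 : ℝ) < d := by positivity
  have hs0 : 0 < s := hd0.trans hs₁
  have hηβ : 0 < η * β := mul_pos hη₀ hβ
  have hγ1 : γ < 1 := by rw [hγ, div_lt_one (by positivity)]; exact hs₂
  have hθ0 : 0 < θ := by
    rw [hθ]
    exact mul_pos (by positivity) (sub_pos.2 (max_lt hγ₁' hγ₂'))
  have hc := LongRange.cZero_pos p hp hd
  obtain ⟨y₀, hy₀1, hy₀⟩ := LongRange.exists_threshold (s := s) hη₁ hγ1
  set c₂ := η * β * LongRange.cZero p / 2 with hc₂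
  have hc₂0 : 0 < c₂ := by positivity
  -- `2√2` comes from the tails of `Z` and `Z'`; the exponential makes the bound at least `1` when
  -- `p x < y₀`.
  refine ⟨LongRange.isProbabilityMeasure_zLaw p hp hd hηβ, 2 * √2 + Real.exp (c₂ * y₀ ^ θ), c₂,
    by positivity, hc₂0, ?_⟩
  intro Ω _ P _ S S' Z Z' hS hS' hZ hZlaw hZ' hZlaw' hI x
  have hpm := (LongRange.continuous_seminorm p).measurable
  -- This is the largest cutoff with `|x|^(max γ₁ γ₂) * L ≤ r`, and `L^(2d) = |x|^θ` gives the
  -- exponent of the tail.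
  set L : ℝ := p x ^ (θ / (2 * d)) with hL
  have hx0 : 0 ≤ p x := apply_nonneg p x
  have hL0 : 0 ≤ L := Real.rpow_nonneg hx0 _
  let B : Set (LongRange.Space d × LongRange.Space d) :=
    {z | p x < y₀ ∨ L ≤ p z.1 ∨ L ≤ p z.2}
  have hB : MeasurableSet B :=
    (MeasurableSet.const (p x < y₀)).union
      ((measurableSet_le measurable_const (hpm.comp measurable_fst)).union
        (measurableSet_le measurable_const (hpm.comp measurable_snd)))
  refine ⟨(fun ω => (Z ω, Z' ω)) ⁻¹' B, ⟨B, hB, rfl⟩, ?_, ?_⟩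
  · by_cases hxy : p x < y₀
    · calc P.real _ ≤ 1 := measureReal_le_one
        _ ≤ Real.exp (c₂ * y₀ ^ θ) * Real.exp (-(c₂ * p x ^ θ)) := by
          rw [← Real.exp_add, Real.one_le_exp_iff]
          have := Real.rpow_le_rpow hx0 hxy.le hθ0.le
          have := mul_le_mul_of_nonneg_left this hc₂0.le
          linarith
        _ ≤ _ := by
          gcongr
          have : 0 ≤ √2 := Real.sqrt_nonneg 2
          linarith
    · have htail := LongRange.zLaw_tail p hp hd hηβ hL0
      have hLd : L ^ (2 * d) = p x ^ θ := by
        rw [hL, ← Real.rpow_mul_natCast hx0]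
        congr 1
        push_cast
        field_simp
      rw [← hc₂, hLd] at htail
      have hmL : MeasurableSet {z | L ≤ p z} := measurableSet_le measurable_const hpm
      have h1 : P.real (Z ⁻¹' {z | L ≤ p z}) ≤ √2 * Real.exp (-(c₂ * p x ^ θ)) := by
        rw [measureReal_def, ← Measure.map_apply hZ hmL, hZlaw]
        exact ENNReal.toReal_le_of_le_ofReal (by positivity) htail
      have h2 : P.real (Z' ⁻¹' {z | L ≤ p z}) ≤ √2 * Real.exp (-(c₂ * p x ^ θ)) := by
        rw [measureReal_def, ← Measure.map_apply hZ' hmL, hZlaw']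
        exact ENNReal.toReal_le_of_le_ofReal (by positivity) htail
      have h3 : P.real ((fun ω => (Z ω, Z' ω)) ⁻¹' B) ≤
          P.real (Z ⁻¹' {z | L ≤ p z}) + P.real (Z' ⁻¹' {z | L ≤ p z}) := by
        refine (measureReal_mono fun ω hω => ?_).trans (measureReal_union_le _ _)
        exact hω.resolve_left hxy
      have h4 : 0 ≤ Real.exp (c₂ * y₀ ^ θ) * Real.exp (-(c₂ * p x ^ θ)) := by positivity
      linarith
  · have hrd := @LongRange.measurable_restrictedDist_comp d p Ω _
    have hA : MeasurableSet ((fun ω => (Z ω, Z' ω)) ⁻¹' B) := (hZ.prodMk hZ') hB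
    have hX := hrd (S := S) (w := fun _ => x) hS.measurable measurable_const
    have hY := hrd (S := S) (w := fun ω => p x ^ γ₁ • Z ω) hS.measurable (by fun_prop)
    have hY' := hrd (S := S') (w := fun ω => p x ^ γ₂ • Z' ω) hS'.measurable (by fun_prop)
    have hind : Measurable (((fun ω => (Z ω, Z' ω)) ⁻¹' B).indicator fun _ => (1 : ℝ)) :=
      measurable_const.indicator hA
    refine LongRange.stochLE_of_measure_lt_le hX
      (((hY.add hY').add_const 1).add (hind.const_mul (p x))) fun t => ?_
    -- For `t > p x` the restricted distance is surely below `t`; for `t ≤ p x` the right-hand side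
    -- can be below `t` only off the exceptional event.
    rcases lt_or_ge (p x) t with ht | ht
    · refine prob_le_one.trans_eq ?_
      symm
      convert measure_univ (μ := P)
      exact Set.eq_univ_of_forall fun ω => (LongRange.restrictedDist_le p (S ω) x).trans_lt ht
    · have hout : ∀ ω, LongRange.restrictedDist p (S ω) 0 (p x ^ γ₁ • Z ω) +
          LongRange.restrictedDist p (S' ω) 0 (p x ^ γ₂ • Z' ω) + 1 +
          p x * ((fun ω => (Z ω, Z' ω)) ⁻¹' B).indicator (fun _ => (1 : ℝ)) ω < t →
          (Z ω, Z' ω) ∉ B := by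
        intro ω hω hB
        rw [Set.indicator_of_mem (by exact hB)] at hω
        have := LongRange.restrictedDist_nonneg p (S ω) 0 (p x ^ γ₁ • Z ω)
        have := LongRange.restrictedDist_nonneg p (S' ω) 0 (p x ^ γ₂ • Z' ω)
        linarith
      by_cases hxy : p x < y₀
      · refine (measure_mono_null (t := ∅) (fun ω hω => ?_) measure_empty).trans_le zero_le
        exact hout ω hω (Or.inl hxy)
      · have hx1 : 1 ≤ p x := hy₀1.trans (not_lt.1 hxy)
        have hxpos : 0 < p x := by linarith
        obtain ⟨hr, hrs⟩ := hy₀ (p x) (not_lt.1 hxy)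
        have hexp : ∀ g, g ≤ max γ₁ γ₂ → p x ^ g * L ≤ p x ^ ((1 + γ) / 2) := by
          intro g hg
          rw [hL, ← Real.rpow_add hxpos]
          refine Real.rpow_le_rpow_of_exponent_le hx1 ?_
          rw [hθ, mul_div_cancel_left₀ _ (by positivity)]
          linarith
        refine (measure_mono fun ω hω => ?_).trans
          (LongRange.measure_shortPairs_le hp hd hβ hη₀ hs0 (Real.rpow_pos_of_pos hxpos γ₁)
            (Real.rpow_pos_of_pos hxpos γ₂) (Real.rpow_pos_of_pos hxpos ((1 + γ) / 2))
            (hexp γ₁ (le_max_left _ _)) (hexp γ₂ (le_max_right _ _)) hr ?_ hrs hS hS' hZ hZlaw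
            hZ' hZlaw' hI t)
        · have hnB := hout ω hω
          have hnB' : ¬ (p x < y₀ ∨ L ≤ p (Z ω) ∨ L ≤ p (Z' ω)) := hnB
          push Not at hnB'
          refine ⟨⟨hnB'.2.1, hnB'.2.2⟩, ?_⟩
          have hω' := hω
          rw [Set.mem_ofPred_eq, Set.indicator_of_notMem (by exact hnB), mul_zero,
            add_zero] at hω'
          exact hω'
        -- `(ab)^d = |x|^(2γd) = |x|^s`.
        · rw [← Real.rpow_add hxpos, hsum, ← Real.rpow_mul_natCast hx0, hγ]
          congr 1
          field_simp
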